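/- **Setting.** Let $k$ be an algebraically closed field of characteristic $p>0$ or $0$. Let $R$ be the coordinate ring of a nonempty affine open subset of a nonsingular variety $W$ of dimension $d$ over $k$; that is, $R$ is an integral domain which is a smooth $k$-algebra of finite type, of Krull dimension $d$. An *idealistic filtration* $\mathbb I$ over $R$ is a family of ideals $(\mathbb I_a)_{a\in\mathbb R}$ of $R$ with $\mathbb I_0=R$, $\mathbb I_a\mathbb I_b\subset \mathbb I_{a+b}$ for all $a,b$, and $\mathbb I_a\subset \mathbb I_b$ whenever $b\le a$. It is *$\mathfrak D$-saturated* if $D(\mathbb I_a)\subset \mathbb I_{a-n}$ for every $a\in\mathbb R$, every $n\in\mathbb Z_{\ge0}$ and every $k$-linear differential operator $D:R\to R$ of order $\le n$ (in the sense of Grothendieck). For a closed point $P$ of $\operatorname{Spec}R$, let $\mathfrak m_P$ be the maximal ideal of $R_P$, let $G_P=\bigoplus_{n\ge 0}\mathfrak m_P^n/\mathfrak m_P^{n+1}$, and put $$L(\mathbb I_P)_n=\{f \bmod \mathfrak m_P^{n+1} \mid f\in \mathbb I_nR_P\cap \mathfrak m_P^n\}\subset \mathfrak m_P^n/\mathfrak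 m_P^{n+1}.$$ If $\operatorname{char} k=p>0$ and $e\in\mathbb Z_{\ge0}$, put $$L(\mathbb I_P)^{\mathrm{pure}}_{p^e}=L(\mathbb I_P)_{p^e}\cap F^e\bigl(\mathfrak m_P/\mathfrak m_P^2\bigr),$$ where $F^e$ is the $e$-th iterate of the Frobenius map of $G_P$, sending the class of $x\in\mathfrak m_P$ to the class of $x^{p^e}$ in $\mathfrak m_P^{p^e}/\mathfrak m_P^{p^e+1}$. If $\operatorname{char}k=0$, only $e=0$ is considered, with $p^0=1$ and $L(\mathbb I_P)^{\mathrm{pure}}_1=L(\mathbb I_P)_1$. Set $l^{\mathrm{pure}}_{p^e}(P)=\dim_kL(\mathbb I_P)^{\mathrm{pure}}_{p^e}$. **Proposition.** Let $\mathbb I$ be a $\mathfrak D$-saturated idealistic filtration over $R$. Then each $l^{\mathrm{pure}}_{p^e}(P)$ is finite and at most $d$, so that $$\sigma(P)=\bigl(d-l^{\mathrm{pure}}_{p^e}(P)\bigr)_{e\in\mathbb Z_{\ge0}}$$ defines a map $\sigma$ from the set of closed points of $\operatorname{Spec}R$, with the Zariski topology, to $\prod_{e\in\mathbb Z_{\ge0}}\mathbb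 Z_{\ge0}$ with the lexicographic order. (If $\operatorname{char} k=0$, the sequence has the single term $d-\dim_k L(\mathbb I_P)_1\in\mathbb Z_{\ge 0}$.) This map is upper semi-continuous: for every $t$ in the target, the set $\{P\mid \sigma(P)\ge t\}$ is closed. -/

import Mathlib

universe u v

/-- A filtration of `R` by ideals indexed by the real numbers.  The ideal `level a` is
`{f | (f, a) ∈ 𝕀}` when the idealistic filtration `𝕀` is regarded as a subset of `R × ℝ`. -/
structure IdealisticFiltration (R : Type v) [CommRing R] where
  /-- The ideal of elements at level `a`. -/
  level : ℝ → Ideal R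
  level_zero : level 0 = ⊤
  level_mul_le : ∀ a b : ℝ, level a * level b ≤ level (a + b)
  level_antitone : ∀ a b : ℝ, b ≤ a → level a ≤ level b

/-- `IsDiffOp k R n D`: the `k`-linear map `D : R → R` is a differential operator of order
(degree) at most `n` in the sense of Grothendieck.  Order at most `0` means that `D` is
`R`-linear; order at most `n + 1` means that every commutator `[D, r]`, `r ∈ R`, has order at
most `n`. -/
def IsDiffOp (k : Type u) (R : Type v) [CommRing k] [CommRing R] [Algebra k R] :
    ℕ → (R →ₗ[k] R) → Prop
  | 0, D => ∀ r : R, D ∘ₗ LinearMap.mulLeft k r - LinearMap.mulLeft k r ∘ₗ D = 0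
  | n + 1, D => ∀ r : R, IsDiffOp k R n (D ∘ₗ LinearMap.mulLeft k r - LinearMap.mulLeft k r ∘ₗ D)

namespace IdealisticFiltration

variable (k : Type u) {R : Type v} [Field k] [CommRing R] [Algebra k R]

/-- `𝔇`-saturation: `(f, a) ∈ 𝕀` implies `(D f, a - n) ∈ 𝕀` for each differential operator `D`
of order at most `n`. -/
def IsDSaturated (I : IdealisticFiltration R) : Prop :=
  ∀ (n : ℕ) (D : R →ₗ[k] R), IsDiffOp k R n D →
    ∀ (a : ℝ) (f : R), f ∈ I.level a → D f ∈ I.level (a - n)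

/-- The localization `𝕀_P` at a maximal ideal `P`: its level `a` is the extension of the
level `a` of `𝕀` to `R_P`. -/
def localizedLevel (I : IdealisticFiltration R) (P : MaximalSpectrum R) (a : ℝ) :
    Ideal (Localization.AtPrime P.asIdeal) :=
  (I.level a).map (algebraMap R (Localization.AtPrime P.asIdeal))

/-- The localization at `P` of an idealistic filtration is an idealistic filtration. -/
def localization (I : IdealisticFiltration R) (P : MaximalSpectrum R) :
    IdealisticFiltration (Localization.AtPrime P.asIdeal) where
  level := I.localizedLevel P
  level_zero := by rw [localizedLevel, I.level_zero, Ideal.map_top]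
  level_mul_le a b := by
    simp only [localizedLevel, ← Ideal.map_mul]
    exact Ideal.map_mono (I.level_mul_le a b)
  level_antitone a b h := Ideal.map_mono (I.level_antitone a b h)

/-- The ambient space `R_P / 𝔪_P ^ (n + 1)` of the degree `n` component `𝔪_P ^ n / 𝔪_P ^ (n + 1)`
of the graded ring `G_P`. -/
abbrev Ambient (P : MaximalSpectrum R) (n : ℕ) : Type v :=
  Localization.AtPrime P.asIdeal ⧸
    (IsLocalRing.maximalIdeal (Localization.AtPrime P.asIdeal)) ^ (n + 1)

/-- The degree `n` component `L(𝕀_P)_n = {f mod 𝔪_P ^ (n + 1) | (f, n) ∈ 𝕀_P, f ∈ 𝔪_P ^ n}` of the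
leading algebra, as a `k`-subspace of `𝔪_P ^ n / 𝔪_P ^ (n + 1) ⊆ R_P / 𝔪_P ^ (n + 1)`. -/
def leadingPart (I : IdealisticFiltration R) (P : MaximalSpectrum R) (n : ℕ) :
    Submodule k (Ambient P n) :=
  (((I.localization P).level n ⊓
      (IsLocalRing.maximalIdeal (Localization.AtPrime P.asIdeal)) ^ n).restrictScalars k).map
    (Ideal.Quotient.mkₐ k _).toLinearMap

/-- The image `F^e((G_P)_1)` of the `e`-th iterate of the Frobenius map of `G_P` on the degree
one component `(G_P)_1 = 𝔪_P / 𝔪_P ^ 2`: the classes of `x ^ (p ^ e)` in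
`𝔪_P ^ (p ^ e) / 𝔪_P ^ (p ^ e + 1)` for `x ∈ 𝔪_P`. Here `p` is the exponential characteristic. -/
def frobeniusImage [IsAlgClosed k] (p : ℕ) [ExpChar k p] (P : MaximalSpectrum R) (e : ℕ) :
    Submodule k (Ambient P (p ^ e)) where
  carrier := {y | ∃ x ∈ IsLocalRing.maximalIdeal (Localization.AtPrime P.asIdeal),
    Ideal.Quotient.mk _ (x ^ (p ^ e)) = y}
  zero_mem' := ⟨0, zero_mem _, by
    rw [zero_pow (pow_ne_zero e (expChar_pos k p).ne'), map_zero]⟩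
  add_mem' := by
    rintro _ _ ⟨x, hx, rfl⟩ ⟨y, hy, rfl⟩
    have : ExpChar (Localization.AtPrime P.asIdeal) p :=
      expChar_of_injective_algebraMap
        (algebraMap k (Localization.AtPrime P.asIdeal)).injective p
    exact ⟨x + y, add_mem hx hy, by rw [add_pow_expChar_pow, map_add]⟩
  smul_mem' := by
    rintro c _ ⟨x, hx, rfl⟩
    obtain ⟨c', hc⟩ := IsAlgClosed.exists_pow_nat_eq c (pow_pos (expChar_pos k p) e)
    refine ⟨c' • x, ?_, ?_⟩
    · rw [Algebra.smul_def]
      exact Ideal.mul_mem_left _ _ hx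
    · rw [smul_pow, hc]
      rfl

/-- The pure part `L(𝕀_P)_{p^e}^pure = L(𝕀_P)_{p^e} ∩ F^e((G_P)_1)`. -/
def purePart [IsAlgClosed k] (p : ℕ) [ExpChar k p] (I : IdealisticFiltration R)
    (P : MaximalSpectrum R) (e : ℕ) : Submodule k (Ambient P (p ^ e)) :=
  I.leadingPart k P (p ^ e) ⊓ frobeniusImage k p P e

/-- The dimension over `k` of the pure part. -/
noncomputable def pureDim [IsAlgClosed k] (p : ℕ) [ExpChar k p] (I : IdealisticFiltration R)
    (P : MaximalSpectrum R) (e : ℕ) : ℕ :=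
  Module.finrank k (I.purePart k p P e)

/-- The invariant `σ(P) = (d - dim L(𝕀_P)_{p^e}^pure)_e`, a sequence of natural numbers, where the
sequences carry the lexicographic order. In characteristic zero (where `p = 1`) only the term at
`e = 0` is meaningful; the sequence is then constant. -/
noncomputable def sigma [IsAlgClosed k] (p : ℕ) [ExpChar k p] (d : ℕ)
    (I : IdealisticFiltration R) (P : MaximalSpectrum R) : Lex (ℕ → ℕ) :=
  toLex fun e => d - I.pureDim k p P e

end IdealisticFiltration

/-!
The invariant `σ` is read off from the leading algebra of the filtration at a closed point `P`, that
is, from the graded algebra of the leading forms at `P` of elements of level `n` vanishing to order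
at least `n`. The proof compares the dimensions of its graded pieces at nearby points.

**Local coordinates and differential operators.** At a closed point, choose `x` in `P` whose classes
form a basis of `P / P ^ 2`; since `R` is smooth, the dual basis lifts to derivations of `R`
(`exists_isLocalCoordinates`). Formal smoothness integrates these derivations to a truncated Taylor
homomorphism (`exists_truncated_taylor`), and its coefficients are differential operators which act
on forms in `x`, to leading order at `P`, as divided partial derivatives
(`exists_diffOp_taylor_coeff`). Hence the graded ring at `P` is a polynomial ring in `x`, the
coordinates are algebraically independent, and there are at most `d` of them by Noether
normalization (`IsLocalCoordinates.le_ringKrullDim`). Over a perfect field the pure part in degree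
`p ^ e` is a Frobenius twist of a space of linear forms (`finite_purePart_and_pureDim_eq`), so its
dimension is at most `d` as well.

**Structure of the leading algebra.** By saturation the leading algebra is stable under divided
partial derivatives. In characteristic `p` it is therefore generated by its pure parts, and in
coordinates adapted to the flag of the pure parts it is spanned by monomials
(`mem_iff_support_subset_adaptedExponents`). Consequently, when the dimensions of the pure parts in
degrees below `p ^ e` are fixed, the dimension of the leading algebra in degree `p ^ e` depends only
on, and strictly increases with, that of the pure part in this degree (`ncard_adaptedExponents_lt`).
In characteristic zero the pure part is the whole leading algebra in degree one.

**Semi-continuity.** As functionals on forms at `P₀` come from differential operators on `R`, linear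
independence of leading forms at `P₀` is witnessed by a determinant in `R`, and it persists at the
points `P` near `P₀` where the elements of level `n` vanish to order at least `n`
(`exists_notMem_forall_finrank_formSpace_le`). At the other points saturation produces an element of
level one which is a unit at `P`, so that the leading algebra is the whole graded ring, and the pure
part has the dimension of the cotangent space, which does not drop either (`pureVectors_eq_top`,
`IsLocalCoordinates.exists_notMem_forall_le`). So, near `P₀`, if the terms of `σ` before the `e`-th
one keep their values, the `e`-th one does not increase (`exists_notMem_forall_pureDim_le`). Since a
strict lexicographic inequality is decided by finitely many terms, this is upper semi-continuity.
-/

open MvPolynomial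

/-! ### Differential operators and truncated Taylor homomorphisms -/

theorem IsDiffOp.map_pow_le {k : Type u} {R : Type v} [CommRing k] [CommRing R] [Algebra k R]
    (P : Ideal R) {n : ℕ} {D : R →ₗ[k] R} (hD : IsDiffOp k R n D) {a : ℕ} {f : R}
    (hf : f ∈ P ^ a) : D f ∈ P ^ (a - n) := by
  induction n generalizing D a f with
  | zero =>
    have h := LinearMap.congr_fun (hD f) 1
    simp only [LinearMap.sub_apply, LinearMap.comp_apply, LinearMap.mulLeft_apply, mul_one,
      LinearMap.zero_apply, sub_eq_zero] at h
    rw [h]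
    exact Ideal.mul_mem_right _ _ hf
  | succ n ih =>
    induction a generalizing f with
    | zero => simp
    | succ a iha =>
      rw [pow_succ'] at hf
      refine Submodule.mul_induction_on hf (fun r hr g hg => ?_) (fun x y hx hy => ?_)
      · have h := ih (hD r) hg
        simp only [LinearMap.sub_apply, LinearMap.comp_apply, LinearMap.mulLeft_apply] at h
        have h2 : r * D g ∈ P ^ (a + 1 - (n + 1)) := by
          refine Ideal.pow_le_pow_right (n := a - (n + 1) + 1) (by omega) ?_
          rw [pow_succ']
          exact Ideal.mul_mem_mul hr (iha hg)
        rw [Nat.add_sub_add_right] at h2 ⊢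
        simpa using add_mem h h2
      · rw [map_add]
        exact add_mem hx hy

/-- Composing a homomorphism `ψ : R → B` which is the structure map modulo `J` with an `R`-linear
functional on `B / J ^ (n + 1)` yields a differential operator of order at most `n`: a commutator
with `r` replaces the functional by its multiple by `ψ r - r ∈ J`. -/
theorem isDiffOp_of_algHom {k : Type u} {R : Type v} [CommRing k] [CommRing R] [Algebra k R]
    {B : Type*} [CommRing B] [Algebra k B] [Algebra R B] [IsScalarTower k R B]
    (ψ : R →ₐ[k] B) (J : Ideal B) (hψ : ∀ r, ψ r - algebraMap R B r ∈ J) (n : ℕ)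
    (φ : B →ₗ[R] R) (hφ : ∀ b ∈ J ^ (n + 1), φ b = 0) :
    IsDiffOp k R n (φ.restrictScalars k ∘ₗ ψ.toLinearMap) := by
  have key : ∀ (φ : B →ₗ[R] R) (r : R),
      (φ.restrictScalars k ∘ₗ ψ.toLinearMap) ∘ₗ LinearMap.mulLeft k r -
        LinearMap.mulLeft k r ∘ₗ (φ.restrictScalars k ∘ₗ ψ.toLinearMap) =
      (φ ∘ₗ LinearMap.mulLeft R (ψ r - algebraMap R B r)).restrictScalars k ∘ₗ
        ψ.toLinearMap := by
    intro φ r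
    ext f
    simp [sub_mul, ← Algebra.smul_def]
  induction n generalizing φ with
  | zero =>
    intro r
    rw [key]
    ext f
    simp only [LinearMap.comp_apply, LinearMap.restrictScalars_apply, LinearMap.mulLeft_apply,
      LinearMap.zero_apply]
    exact hφ _ (by simpa using Ideal.mul_mem_right _ _ (hψ r))
  | succ n ih =>
    intro r
    rw [key]
    refine ih _ fun b hb => ?_
    simp only [LinearMap.comp_apply, LinearMap.mulLeft_apply]
    refine hφ _ ?_
    rw [pow_succ']
    exact Ideal.mul_mem_mul (hψ r) hb

/-- Over a formally smooth algebra, a family of derivations integrates to a truncated Taylor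
homomorphism `R → R[X] / (X) ^ (N + 1)` with linear part `b ↦ b + ∑ i, δ i b * X i`. -/
theorem exists_truncated_taylor {k : Type u} {R : Type v} [CommRing k] [CommRing R] [Algebra k R]
    [Algebra.FormallySmooth k R] {s : ℕ} (δ : Fin s → Derivation k R R) (N : ℕ) :
    ∃ ψ : R →ₐ[k] MvPolynomial (Fin s) R ⧸ idealOfVars (Fin s) R ^ (N + 1), ∀ b,
      ∃ y : MvPolynomial (Fin s) R, Ideal.Quotient.mk _ y = ψ b ∧
        y - (C b + ∑ i, C (δ i b) * X i) ∈ idealOfVars (Fin s) R ^ 2 := by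
  let J := idealOfVars (Fin s) R
  let B := MvPolynomial (Fin s) R ⧸ J ^ (N + 1)
  let I : Ideal B := (J ^ 2).map (Ideal.Quotient.mk (J ^ (N + 1)))
  have hI : IsNilpotent I := by
    refine ⟨N + 1, ?_⟩
    rw [← Ideal.map_pow, ← pow_mul, Ideal.zero_eq_bot, Ideal.map_eq_bot_iff_le_ker, Ideal.mk_ker]
    exact Ideal.pow_le_pow_right (by omega)
  let T : R → MvPolynomial (Fin s) R := fun b => C b + ∑ i, C (δ i b) * X i
  have hker : ∀ z ∈ J ^ 2, Ideal.Quotient.mk I (Ideal.Quotient.mk (J ^ (N + 1)) z) = 0 :=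
    fun z hz => Ideal.Quotient.eq_zero_iff_mem.2 (Ideal.mem_map_of_mem _ hz)
  have hlin : ∀ b, ∑ i, C (δ i b) * X i ∈ J := fun b =>
    sum_mem fun i _ => Ideal.mul_mem_left _ _ (Ideal.subset_span ⟨i, rfl⟩)
  have hTmul : ∀ a b, T a * T b - T (a * b) ∈ J ^ 2 := by
    intro a b
    have : T a * T b - T (a * b) = (∑ i, C (δ i a) * X i) * (∑ i, C (δ i b) * X i) := by
      have h : (∑ i, C (δ i (a * b)) * X i : MvPolynomial (Fin s) R) =
          C a * (∑ i, C (δ i b) * X i) + C b * (∑ i, C (δ i a) * X i) := by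
        rw [Finset.mul_sum, Finset.mul_sum, ← Finset.sum_add_distrib]
        refine Finset.sum_congr rfl fun i _ => ?_
        simp only [Derivation.leibniz, smul_eq_mul, map_add, map_mul]
        ring
      simp only [T, h, map_mul]
      ring
    rw [this, pow_two]
    exact Ideal.mul_mem_mul (hlin a) (hlin b)
  let τ : R →ₐ[k] B ⧸ I :=
    AlgHom.ofLinearMap
      { toFun := fun b => Ideal.Quotient.mk I (Ideal.Quotient.mk (J ^ (N + 1)) (T b))
        map_add' := fun a b => by
          rw [← map_add, ← map_add]
          congr 2
          simp only [T, map_add, add_mul, Finset.sum_add_distrib]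
          ring
        map_smul' := fun c a => by
          have : T (c • a) = c • T a := by
            simp only [T, Derivation.map_smul, smul_add, Finset.smul_sum]
            congr 1
            · exact (MvPolynomial.smul_monomial c).symm
            · refine Finset.sum_congr rfl fun i _ => ?_
              rw [← smul_mul_assoc]
              congr 1
              exact (MvPolynomial.smul_monomial c).symm
          rw [this]
          rfl }
      (by simp [T])
      (fun a b => by
        rw [← sub_eq_zero]
        change Ideal.Quotient.mk I (Ideal.Quotient.mk (J ^ (N + 1)) (T (a * b))) -
          Ideal.Quotient.mk I (Ideal.Quotient.mk (J ^ (N + 1)) (T a)) *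
          Ideal.Quotient.mk I (Ideal.Quotient.mk (J ^ (N + 1)) (T b)) = 0
        rw [← map_mul, ← map_mul, ← map_sub, ← map_sub]
        refine hker _ ?_
        rw [← neg_sub]
        exact neg_mem (hTmul a b))
  obtain ⟨ψ, hψ⟩ := Algebra.FormallySmooth.exists_lift I hI τ
  refine ⟨ψ, fun b => ?_⟩
  have h : Ideal.Quotient.mk I (ψ b) =
      Ideal.Quotient.mk I (Ideal.Quotient.mk (J ^ (N + 1)) (T b)) := AlgHom.congr_fun hψ b
  rw [Ideal.Quotient.eq, Ideal.mem_map_iff_of_surjective _ Ideal.Quotient.mk_surjective] at h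
  obtain ⟨w, hw, hwe⟩ := h
  exact ⟨T b + w, by rw [map_add, hwe]; ring, by simpa [T] using hw⟩

/-- Coefficients of the elements of `(P, X) ^ m`. -/
theorem coeff_mem_of_mem_pow_sup {R : Type v} [CommRing R] {s : ℕ} (P : Ideal R) {m : ℕ}
    {F : MvPolynomial (Fin s) R} (hF : F ∈ (P.map C ⊔ idealOfVars (Fin s) R) ^ m)
    (β : Fin s →₀ ℕ) : F.coeff β ∈ P ^ (m - β.degree) := by
  classical
  induction m generalizing F β with
  | zero => simp
  | succ m ih =>
    have hspan : P.map C ⊔ idealOfVars (Fin s) R = Ideal.span (C '' P ∪ Set.range X) := by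
      rw [Ideal.span_union, Ideal.map]
    rw [pow_succ'] at hF
    refine Submodule.mul_induction_on hF (fun r hr => ?_) (fun x y hx hy => ?_)
    · rw [hspan] at hr
      refine Submodule.span_induction ?_ ?_ ?_ ?_ hr
      · rintro _ (⟨a, ha, rfl⟩ | ⟨i, rfl⟩) g hg
        · rw [coeff_C_mul]
          refine Ideal.pow_le_pow_right (n := m - β.degree + 1) (by omega) ?_
          rw [pow_succ']
          exact Ideal.mul_mem_mul ha (ih hg β)
        · rw [coeff_X_mul']
          split_ifs with hi
          · have h := ih hg (β - Finsupp.single i 1)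
            have hd : β.degree = (β - Finsupp.single i 1).degree + 1 := by
              have : β = (β - Finsupp.single i 1) + Finsupp.single i 1 := by
                rw [tsub_add_cancel_of_le]
                rw [Finsupp.single_le_iff]
                exact Nat.one_le_iff_ne_zero.2 (Finsupp.mem_support_iff.1 hi)
              conv_lhs => rw [this]
              simp
            rwa [hd, Nat.add_sub_add_right]
          · exact zero_mem _
      · intro g _
        simp
      · intro x y _ _ hx hy g hg
        rw [add_mul, coeff_add]
        exact add_mem (hx g hg) (hy g hg)
      · intro a x _ hx g hg
        rw [smul_eq_mul, mul_comm a x, mul_assoc]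
        exact hx _ (Ideal.mul_mem_left _ _ hg)
    · rw [coeff_add]
      exact add_mem hx hy

/-- Replacing `n` factors in an ideal by factors congruent modulo the square of the ideal does not
change a product modulo the `(n + 1)`-st power. -/
theorem Ideal.prod_pow_sub_prod_pow_mem {A : Type*} [CommRing A] {ι : Type*} (J : Ideal A)
    (t : Finset ι) (γ : ι → ℕ) (a b : ι → A) (ha : ∀ i, a i ∈ J) (hb : ∀ i, b i ∈ J)
    (hab : ∀ i, a i - b i ∈ J ^ 2) :
    ∏ i ∈ t, a i ^ γ i - ∏ i ∈ t, b i ^ γ i ∈ J ^ (∑ i ∈ t, γ i + 1) := by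
  classical
  have mul : ∀ {m n : ℕ} {u u' w w' : A}, u' ∈ J ^ m → w ∈ J ^ n → u - u' ∈ J ^ (m + 1) →
      w - w' ∈ J ^ (n + 1) → u * w - u' * w' ∈ J ^ (m + n + 1) := by
    intro m n u u' w w' hu' hw hu hww
    have : u * w - u' * w' = (u - u') * w + u' * (w - w') := by ring
    rw [this]
    refine add_mem ?_ ?_
    · have := Ideal.mul_mem_mul hu hw
      rw [← pow_add] at this
      convert this using 2
      ring
    · have := Ideal.mul_mem_mul hu' hww
      rw [← pow_add] at this
      rwa [add_assoc]
  have pw : ∀ i n, a i ^ n - b i ^ n ∈ J ^ (n + 1) := by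
    intro i n
    induction n with
    | zero => simp
    | succ n ih =>
      rw [pow_succ (a i), pow_succ (b i)]
      refine mul (m := n) (n := 1) (Ideal.pow_mem_pow (hb i) n) (by simpa using ha i) ih ?_
      simpa using hab i
  induction t using Finset.induction_on with
  | empty => simp
  | insert i t hi ih =>
    rw [Finset.prod_insert hi, Finset.prod_insert hi, Finset.sum_insert hi]
    refine mul (Ideal.pow_mem_pow (hb i) _) ?_ (pw i _) ih
    rw [← Finset.prod_pow_eq_pow_sum]
    exact Ideal.prod_mem_prod fun j _ => Ideal.pow_mem_pow (ha j) _

/-- Differential operators `D β` of order `|β|` which act on the monomials in local coordinates `x`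
at `P` like the divided partial derivatives, to leading order at `P`. -/
theorem exists_diffOp_taylor_coeff {k : Type u} {R : Type v} [CommRing k] [CommRing R]
    [Algebra k R] [Algebra.FormallySmooth k R] (P : Ideal R) {s : ℕ} (x : Fin s → R)
    (hx : ∀ i, x i ∈ P) (δ : Fin s → Derivation k R R)
    (hδ : ∀ i j, δ i (x j) - (if i = j then 1 else 0) ∈ P) (β : Fin s →₀ ℕ) :
    ∃ D : R →ₗ[k] R, IsDiffOp k R β.degree D ∧ ∀ γ : Fin s →₀ ℕ,
      D (∏ i, x i ^ γ i) - coeff β (∏ i, (C (x i) + X i) ^ γ i) ∈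
        P ^ (γ.degree + 1 - β.degree) := by
  obtain ⟨ψ, hψ⟩ := exists_truncated_taylor δ β.degree
  let J := idealOfVars (Fin s) R
  let φ : (MvPolynomial (Fin s) R ⧸ J ^ (β.degree + 1)) →ₗ[R] R :=
    Submodule.liftQ ((J ^ (β.degree + 1)).restrictScalars R) (lcoeff R β) (fun z hz => by
      have := (mem_pow_idealOfVars_iff' _ _).1 ((Submodule.restrictScalars_mem ..).1 hz) β
        (Nat.lt_succ_self _)
      simpa using this) ∘ₗ (Submodule.Quotient.restrictScalarsEquiv R (J ^ (β.degree + 1))).symm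
  have hφ : ∀ y, φ (Ideal.Quotient.mk _ y) = coeff β y := fun y => rfl
  have hJ : ∀ b, ∑ i, C (δ i b) * X i ∈ J := fun b =>
    sum_mem fun i _ => Ideal.mul_mem_left _ _ (Ideal.subset_span ⟨i, rfl⟩)
  refine ⟨φ.restrictScalars k ∘ₗ ψ.toLinearMap,
    isDiffOp_of_algHom ψ (J.map (Ideal.Quotient.mk _)) (fun r => ?_) _ φ (fun b hb => ?_), ?_⟩
  · obtain ⟨y, hy, hy2⟩ := hψ r
    rw [← hy]
    change Ideal.Quotient.mk _ y - Ideal.Quotient.mk _ (C r) ∈ _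
    rw [← map_sub]
    refine Ideal.mem_map_of_mem _ ?_
    have : y - C r = (y - (C r + ∑ i, C (δ i r) * X i)) + ∑ i, C (δ i r) * X i := by ring
    rw [this]
    exact add_mem (Ideal.pow_le_self two_ne_zero hy2) (hJ r)
  · rw [← Ideal.map_pow, Ideal.mem_map_iff_of_surjective _ Ideal.Quotient.mk_surjective] at hb
    obtain ⟨w, hw, rfl⟩ := hb
    rw [hφ]
    exact (mem_pow_idealOfVars_iff' _ _).1 hw β (Nat.lt_succ_self _)
  · intro γ
    choose y hy hy2 using fun i => hψ (x i)
    have h1 : (φ.restrictScalars k ∘ₗ ψ.toLinearMap) (∏ i, x i ^ γ i) =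
        coeff β (∏ i, y i ^ γ i) := by
      rw [← hφ]
      change φ (ψ (∏ i, x i ^ γ i)) = _
      congr 1
      simp only [map_prod, map_pow, ← hy, J]
    rw [h1, ← coeff_sub]
    let 𝔑 : Ideal (MvPolynomial (Fin s) R) := P.map C ⊔ J
    have hC : ∀ a ∈ P, C a ∈ 𝔑 := fun a ha => Ideal.mem_sup_left (Ideal.mem_map_of_mem _ ha)
    have hX : ∀ i, X i ∈ 𝔑 := fun i => Ideal.mem_sup_right (Ideal.subset_span ⟨i, rfl⟩)
    have hsub : ∀ i, y i - (C (x i) + X i) ∈ 𝔑 ^ 2 := by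
      intro j
      have : y j - (C (x j) + X j) = (y j - (C (x j) + ∑ i, C (δ i (x j)) * X i)) +
          ∑ i, C (δ i (x j) - (if i = j then 1 else 0)) * X i := by
        have : (∑ i, C (δ i (x j) - (if i = j then 1 else 0)) * X i : MvPolynomial (Fin s) R) =
            (∑ i, C (δ i (x j)) * X i) - X j := by
          simp only [map_sub, sub_mul, Finset.sum_sub_distrib]
          congr 1
          rw [Finset.sum_eq_single j]
          · simp
          · intro i _ hi
            simp [hi]
          · simp
        rw [this]
        ring
      rw [this]
      refine add_mem (Ideal.pow_right_mono le_sup_right 2 (hy2 j)) (sum_mem fun i _ => ?_)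
      rw [pow_two]
      exact Ideal.mul_mem_mul (hC _ (hδ i j)) (hX i)
    have hb : ∀ i, C (x i) + X i ∈ 𝔑 := fun i => add_mem (hC _ (hx i)) (hX i)
    have ha : ∀ i, y i ∈ 𝔑 := fun i => by
      simpa using add_mem (Ideal.pow_le_self two_ne_zero (hsub i)) (hb i)
    have := Ideal.prod_pow_sub_prod_pow_mem 𝔑 Finset.univ γ y _ ha hb hsub
    rw [← Finsupp.degree_eq_sum] at this
    exact coeff_mem_of_mem_pow_sup P this β

/-- Modulo `P ∋ x i`, the Taylor expansion `∏ i, (x i + X i) ^ γ i` is the monomial `X ^ γ`. -/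
theorem coeff_prod_add_X_sub_mem {R : Type v} [CommRing R] (P : Ideal R) {s : ℕ}
    (x : Fin s → R) (hx : ∀ i, x i ∈ P) (β γ : Fin s →₀ ℕ) :
    coeff β (∏ i, (C (x i) + X i) ^ γ i) - (if γ = β then 1 else 0) ∈ P := by
  classical
  have h : (∏ i, (C (x i) + X i) ^ γ i : MvPolynomial (Fin s) R) - monomial γ 1 ∈ P.map C := by
    have hm : (monomial γ 1 : MvPolynomial (Fin s) R) = ∏ i, X i ^ γ i := by
      rw [monomial_eq, Finsupp.prod_fintype _ _ (by simp)]
      simp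
    rw [hm, ← Ideal.Quotient.eq, map_prod, map_prod]
    refine Finset.prod_congr rfl fun i _ => ?_
    rw [map_pow, map_pow, map_add, Ideal.Quotient.eq_zero_iff_mem.2
      (Ideal.mem_map_of_mem C (hx i)), zero_add]
  have := mem_map_C_iff.1 h β
  rwa [coeff_sub, coeff_monomial] at this

theorem coeff_single_prod_add_X {R : Type v} [CommRing R] {s : ℕ}
    (x : Fin s → R) (j : Fin s) (r : ℕ) (γ : Fin s →₀ ℕ) :
    coeff (Finsupp.single j r) (∏ i, (C (x i) + X i) ^ γ i) =
      (γ j).choose r * (x j ^ (γ j - r) * ∏ i ∈ Finset.univ.erase j, x i ^ γ i) := by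
  classical
  have key : ∀ F : MvPolynomial (Fin s) R, coeff (Finsupp.single j r) F =
      (aeval (fun i => if i = j then (Polynomial.X : Polynomial R) else 0) F).coeff r := by
    intro F
    induction F using MvPolynomial.induction_on' with
    | add p q hp hq => simp [hp, hq]
    | monomial u a =>
      rw [coeff_monomial, aeval_monomial, Polynomial.algebraMap_eq, Polynomial.coeff_C_mul,
        Finsupp.prod_fintype _ _ (by simp)]
      by_cases hu : ∀ i, i ≠ j → u i = 0
      · have hu' : u = Finsupp.single j (u j) := by
          ext i
          by_cases hi : i = j
          · subst hi; simp
          · simp [hu i hi, Ne.symm hi]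
        rw [Finset.prod_eq_single j]
        · simp only [if_true, Polynomial.coeff_X_pow]
          by_cases h : u j = r
          · rw [if_pos (by rw [hu', h]), if_pos h.symm, mul_one]
          · rw [if_neg, if_neg (Ne.symm h), mul_zero]
            intro h'
            apply h
            rw [h']
            simp
        · intro i _ hi
          simp [hu i hi]
        · simp
      · push Not at hu
        obtain ⟨i, hij, hi⟩ := hu
        rw [if_neg, Finset.prod_eq_zero (Finset.mem_univ i)]
        · simp
        · simp [hij, hi]
        · rintro rfl
          simp [Ne.symm hij] at hi
  rw [key, map_prod, ← Finset.mul_prod_erase _ _ (Finset.mem_univ j)]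
  have : ∏ i ∈ Finset.univ.erase j, (aeval (fun i => if i = j then (Polynomial.X : Polynomial R)
      else 0)) ((C (x i) + X i) ^ γ i) =
      Polynomial.C (∏ i ∈ Finset.univ.erase j, x i ^ γ i) := by
    rw [map_prod]
    refine Finset.prod_congr rfl fun i hi => ?_
    simp [Finset.ne_of_mem_erase hi]
  rw [this, Polynomial.coeff_mul_C]
  simp only [map_pow, map_add, aeval_C, aeval_X, if_true, Polynomial.algebraMap_eq]
  rw [add_comm, Polynomial.coeff_X_add_C_pow]
  ring

/-! ### Local coordinates at a closed point -/

/-- Over an algebraically closed field, the residue field at a closed point of a scheme of finite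
type is the ground field; `ev` is evaluation at that point. -/
theorem exists_evaluation (k : Type u) {R : Type v} [Field k] [IsAlgClosed k] [CommRing R]
    [Algebra k R] [Algebra.FiniteType k R] (P : Ideal R) [P.IsMaximal] :
    ∃ ev : R →ₐ[k] k, ∀ r, r ∈ P ↔ ev r = 0 := by
  let := Ideal.Quotient.field P
  have : Algebra.FiniteType k (R ⧸ P) :=
    Algebra.FiniteType.of_surjective (Ideal.Quotient.mkₐ k P) (Ideal.Quotient.mkₐ_surjective k P)
  have : Module.Finite k (R ⧸ P) := finite_of_finite_type_of_isJacobsonRing k (R ⧸ P)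
  have hbij : Function.Bijective (Algebra.ofId k (R ⧸ P)) :=
    IsAlgClosed.algebraMap_bijective_of_isIntegral
  refine ⟨((AlgEquiv.ofBijective _ hbij).symm : (R ⧸ P) →ₐ[k] k).comp (Ideal.Quotient.mkₐ k P),
    fun r => ?_⟩
  simp [Ideal.Quotient.eq_zero_iff_mem]

/-- Local coordinates `x` at the `k`-rational point `P`: elements of `P` whose classes form a
`k`-basis of `P / P ^ 2`, the independence being witnessed by dual derivations of `R`. -/
structure IsLocalCoordinates (k : Type u) {R : Type v} [Field k] [CommRing R] [Algebra k R]
    (P : Ideal R) {s : ℕ} (x : Fin s → R) : Prop where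
  mem : ∀ i, x i ∈ P
  exists_linear : ∀ a ∈ P, ∃ v : Fin s → k, a - ∑ i, v i • x i ∈ P ^ 2
  exists_derivation : ∃ δ : Fin s → Derivation k R R,
    ∀ i j, δ i (x j) - (if i = j then 1 else 0) ∈ P

section

variable {k : Type u} {R : Type v} [Field k] [CommRing R] [Algebra k R]

theorem exists_isLocalCoordinates [IsAlgClosed k] [Algebra.Smooth k R] (P : Ideal R)
    [P.IsMaximal] : ∃ (s : ℕ) (x : Fin s → R), IsLocalCoordinates k P x := by
  obtain ⟨ev, hev⟩ := exists_evaluation k P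
  have hsub : ∀ r, r - algebraMap k R (ev r) ∈ P := fun r => by simp [hev]
  have : Algebra.FiniteType k R := inferInstance
  have : IsNoetherianRing R := Algebra.FiniteType.isNoetherianRing k R
  let := Ideal.Quotient.field P
  have : Module.Finite R P := Module.Finite.iff_fg.2 (IsNoetherian.noetherian P)
  have : Module.Finite R P.Cotangent :=
    Module.Finite.of_surjective P.toCotangent P.toCotangent_surjective
  have : Module.Finite (R ⧸ P) P.Cotangent := Module.Finite.of_restrictScalars_finite R _ _
  let b := Module.finBasis (R ⧸ P) P.Cotangent
  choose x hx using fun i => P.toCotangent_surjective (b i)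
  refine ⟨_, fun i => (x i : R), fun i => (x i).2, fun a ha => ?_, ?_⟩
  · have h := b.sum_repr (P.toCotangent ⟨a, ha⟩)
    choose r hr using fun i => Ideal.Quotient.mk_surjective (b.repr (P.toCotangent ⟨a, ha⟩) i)
    refine ⟨fun i => ev (r i), ?_⟩
    have h2 : P.toCotangent ⟨a, ha⟩ = P.toCotangent (∑ i, ev (r i) • x i) := by
      rw [← h, map_sum]
      refine Finset.sum_congr rfl fun i _ => ?_
      rw [← hr, ← hx]
      have h3 : (Ideal.Quotient.mk P (r i)) • P.toCotangent (x i) =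
          r i • P.toCotangent (x i) := rfl
      rw [h3, ← map_smul, Ideal.toCotangent_eq, pow_two]
      have h4 : ((r i • x i : P) : R) - ((ev (r i) • x i : P) : R) =
          (r i - algebraMap k R (ev (r i))) * x i := by
        rw [Submodule.coe_smul, Submodule.coe_smul_of_tower, Algebra.smul_def (ev (r i)),
          smul_eq_mul]
        ring
      rw [h4]
      exact Ideal.mul_mem_mul (hsub _) (x i).2
    have h5 := (Ideal.toCotangent_eq _).1 h2
    simpa using h5
  · have hD : ∀ i, ∃ δ : Derivation k R R, ∀ r, Ideal.Quotient.mk P (δ r) =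
        b.repr (P.toCotangent ⟨r - algebraMap k R (ev r), hsub r⟩) i := by
      intro i
      let d : Derivation k R (R ⧸ P) := Derivation.mk'
        { toFun := fun r => b.repr (P.toCotangent ⟨r - algebraMap k R (ev r), hsub r⟩) i
          map_add' := fun r t => by
            rw [← Finsupp.add_apply, ← map_add, ← map_add]
            congr 3
            ext
            simp only [map_add, Submodule.coe_add]
            ring
          map_smul' := fun c r => by
            have h1 : (⟨c • r - algebraMap k R (ev (c • r)), hsub _⟩ : P) =
                algebraMap k R c • ⟨r - algebraMap k R (ev r), hsub r⟩ := by
              ext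
              simp [Algebra.smul_def, mul_sub]
            rw [h1, map_smul]
            have h2 : ∀ m : P.Cotangent, algebraMap k R c • m =
              (Ideal.Quotient.mk P (algebraMap k R c)) • m := fun m => rfl
            rw [h2, map_smul, Finsupp.smul_apply, RingHom.id_apply, Algebra.smul_def c]
            rfl }
        (fun r t => by
          have h1 : (⟨r * t - algebraMap k R (ev (r * t)), hsub _⟩ : P) =
              r • ⟨t - algebraMap k R (ev t), hsub t⟩ +
              algebraMap k R (ev t) • ⟨r - algebraMap k R (ev r), hsub r⟩ := by
            ext
            simp [Algebra.smul_def]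
            ring
          have h2 : ∀ (a : R) (m : P.Cotangent), a • m = (Ideal.Quotient.mk P a) • m :=
            fun a m => rfl
          have h3 : Ideal.Quotient.mk P t = Ideal.Quotient.mk P (algebraMap k R (ev t)) := by
            rw [Ideal.Quotient.eq]
            exact hsub t
          change b.repr (P.toCotangent ⟨r * t - algebraMap k R (ev (r * t)), hsub _⟩) i =
            Ideal.Quotient.mk P r * _ + Ideal.Quotient.mk P t * _
          rw [h1, map_add, map_smul, map_smul, h2, h2, map_add, map_smul, map_smul,
            Finsupp.add_apply, Finsupp.smul_apply, Finsupp.smul_apply, h3]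
          rfl)
      obtain ⟨ℓ, hℓ⟩ := Module.projective_lifting_property (Submodule.mkQ P)
        (d.liftKaehlerDifferential) (Submodule.mkQ_surjective P)
      refine ⟨ℓ.compDer (KaehlerDifferential.D k R), fun r => ?_⟩
      have := LinearMap.congr_fun hℓ (KaehlerDifferential.D k R r)
      rw [Derivation.liftKaehlerDifferential_comp_D] at this
      exact this
    choose δ hδ using hD
    refine ⟨δ, fun i j => ?_⟩
    rw [← Ideal.Quotient.eq, hδ]
    have h1 : P.toCotangent ⟨x j - algebraMap k R (ev (x j)), hsub _⟩ = b j := by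
      rw [← hx]
      congr 1
      ext
      simp [(hev _).1 (x j).2]
    rw [h1, Module.Basis.repr_self, Finsupp.single_apply]
    by_cases h : i = j <;> simp [h, eq_comm]

/-- An invertible `k`-linear substitution transforms local coordinates into local coordinates. -/
theorem IsLocalCoordinates.change_basis {P : Ideal R} {s : ℕ} {x : Fin s → R}
    (hx : IsLocalCoordinates k P x) (b : Module.Basis (Fin s) k (Fin s → k)) :
    IsLocalCoordinates k P (fun j => ∑ i, b j i • x i) := by
  have hcomb : ∀ v : Fin s → k, ∑ j, b.repr v j • ∑ i, b j i • x i = ∑ i, v i • x i := by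
    intro v
    simp_rw [Finset.smul_sum, smul_smul]
    rw [Finset.sum_comm]
    refine Finset.sum_congr rfl fun i _ => ?_
    rw [← Finset.sum_smul]
    congr 1
    conv_rhs => rw [← b.sum_repr v]
    simp
  obtain ⟨δ, hδ⟩ := hx.exists_derivation
  refine ⟨fun j => sum_mem fun i _ => Submodule.smul_of_tower_mem P _ (hx.mem i), fun a ha => ?_,
    fun a => ∑ i, b.repr (Pi.single i 1) a • δ i, fun a c => ?_⟩
  · obtain ⟨v, hv⟩ := hx.exists_linear a ha
    exact ⟨b.repr v, by rwa [hcomb]⟩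
  · have h1 : (if a = c then (1 : R) else 0) =
        ∑ i, b.repr (Pi.single i 1) a • ∑ m, b c m • (if i = m then (1 : R) else 0) := by
      have h2 : b.repr (∑ i, b c i • Pi.single i (1 : k)) a = if a = c then 1 else 0 := by
        have h3 : ∑ i, b c i • Pi.single i (1 : k) = b c := by
          ext m
          simp [Pi.single_apply]
        rw [h3, Module.Basis.repr_self, Finsupp.single_apply]
        simp only [eq_comm]
      have h4 : (if a = c then (1 : R) else 0) = algebraMap k R (if a = c then 1 else 0) := by
        split_ifs <;> simp
      rw [h4, ← h2]
      simp only [map_sum, map_smul, Finsupp.coe_finsetSum, Finset.sum_apply, Finsupp.smul_apply]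
      refine Finset.sum_congr rfl fun i _ => ?_
      rw [Finset.sum_eq_single i]
      · simp [Algebra.smul_def, mul_comm]
      · intro m _ hm
        simp [Ne.symm hm]
      · simp
    have hsum : ∀ y, (∑ i, b.repr (Pi.single i 1) a • δ i) y =
        ∑ i, (b.repr (Pi.single i 1) a • δ i) y := fun y =>
      map_sum (Pi.evalAddMonoidHom (fun _ : R => R) y |>.comp Derivation.coeFnAddMonoidHom) _ _
    rw [h1, hsum, ← Finset.sum_sub_distrib]
    refine sum_mem fun i _ => ?_
    rw [Derivation.smul_apply, ← smul_sub]
    refine Submodule.smul_of_tower_mem P _ ?_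
    rw [map_sum, ← Finset.sum_sub_distrib]
    refine sum_mem fun m _ => ?_
    rw [Derivation.map_smul, ← smul_sub]
    exact Submodule.smul_of_tower_mem P _ (hδ i m)

theorem aeval_mem_pow_of_isHomogeneous {P : Ideal R} {s : ℕ} {x : Fin s → R}
    (hx : ∀ i, x i ∈ P) {n : ℕ} {F : MvPolynomial (Fin s) k} (hF : F.IsHomogeneous n) :
    aeval x F ∈ P ^ n := by
  rw [aeval_def, eval₂_eq']
  refine sum_mem fun γ hγ => Ideal.mul_mem_left _ _ ?_
  have h : n = ∑ i, γ i := by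
    rw [← Finsupp.degree_eq_sum]
    by_contra hne
    exact mem_support_iff.1 hγ (hF.coeff_eq_zero (Ne.symm hne))
  rw [h, ← Finset.prod_pow_eq_pow_sum]
  exact Ideal.prod_mem_prod fun i _ => Ideal.pow_mem_pow (hx i) _

/-- The powers of `P` are spanned, to leading order, by forms in local coordinates. -/
theorem IsLocalCoordinates.exists_form {P : Ideal R} {s : ℕ} {x : Fin s → R}
    (hx : IsLocalCoordinates k P x) (hP : ∃ ev : R →ₐ[k] k, ∀ r, r ∈ P ↔ ev r = 0) {n : ℕ}
    {f : R} (hf : f ∈ P ^ n) :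
    ∃ F : MvPolynomial (Fin s) k, F.IsHomogeneous n ∧ f - aeval x F ∈ P ^ (n + 1) := by
  induction n generalizing f with
  | zero =>
    obtain ⟨ev, hev⟩ := hP
    exact ⟨C (ev f), isHomogeneous_C _ _, by simp [hev]⟩
  | succ n ih =>
    rw [pow_succ'] at hf
    refine Submodule.mul_induction_on hf (fun a ha g hg => ?_) (fun f g hf hg => ?_)
    · obtain ⟨v, hv⟩ := hx.exists_linear a ha
      obtain ⟨G, hG, hg'⟩ := ih hg
      refine ⟨(∑ i, C (v i) * X i) * G, ?_, ?_⟩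
      · rw [add_comm]
        refine IsHomogeneous.mul (IsHomogeneous.sum _ _ _ fun i _ => ?_) hG
        simpa using (isHomogeneous_C _ (v i)).mul (isHomogeneous_X k i)
      · have h1 : aeval x (∑ i, C (v i) * X i) = ∑ i, v i • x i := by
          simp [Algebra.smul_def]
        have h2 : a * g - (∑ i, v i • x i) * aeval x G =
            (a - ∑ i, v i • x i) * g + (∑ i, v i • x i) * (g - aeval x G) := by ring
        rw [map_mul, h1, h2]
        refine add_mem ?_ ?_
        · have := Ideal.mul_mem_mul hv hg
          rw [← pow_add] at this
          convert this using 2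
          ring
        · rw [pow_succ']
          exact Ideal.mul_mem_mul
            (sum_mem fun i _ => Submodule.smul_of_tower_mem P _ (hx.mem i)) hg'
    · obtain ⟨F, hF, hfF⟩ := hf
      obtain ⟨G, hG, hgG⟩ := hg
      refine ⟨F + G, hF.add hG, ?_⟩
      rw [map_add, add_sub_add_comm]
      exact add_mem hfF hgG

theorem map_aeval_eq_sum {s : ℕ} (D : R →ₗ[k] R) (x : Fin s → R) (F : MvPolynomial (Fin s) k) :
    D (aeval x F) = ∑ γ ∈ F.support, F.coeff γ • D (∏ i, x i ^ γ i) := by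
  rw [aeval_def, eval₂_eq', map_sum]
  refine Finset.sum_congr rfl fun γ _ => ?_
  rw [← Algebra.smul_def, map_smul]

/-- A differential operator of order `|β|` extracting the coefficient at `β` of forms of degree
`|β|` in the local coordinates. -/
theorem IsLocalCoordinates.exists_diffOp_coeff [Algebra.FormallySmooth k R] {P : Ideal R} {s : ℕ}
    {x : Fin s → R} (hx : IsLocalCoordinates k P x) (β : Fin s →₀ ℕ) :
    ∃ D : R →ₗ[k] R, IsDiffOp k R β.degree D ∧ ∀ F : MvPolynomial (Fin s) k,
      F.IsHomogeneous β.degree → D (aeval x F) - algebraMap k R (F.coeff β) ∈ P := by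
  obtain ⟨δ, hδ⟩ := hx.exists_derivation
  obtain ⟨D, hD, hDx⟩ := exists_diffOp_taylor_coeff P x hx.mem δ hδ β
  refine ⟨D, hD, fun F hF => ?_⟩
  have h1 : algebraMap k R (F.coeff β) =
      ∑ γ ∈ F.support, F.coeff γ • (if γ = β then (1 : R) else 0) := by
    simp only [Algebra.smul_def, mul_ite, mul_one, mul_zero, Finset.sum_ite_eq']
    split_ifs with h
    · rfl
    · rw [notMem_support_iff.1 h, map_zero]
  rw [map_aeval_eq_sum, h1, ← Finset.sum_sub_distrib]
  refine sum_mem fun γ hγ => ?_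
  rw [← smul_sub]
  refine Submodule.smul_of_tower_mem P _ ?_
  have hdeg : γ.degree = β.degree := by
    by_contra hne
    exact mem_support_iff.1 hγ (hF.coeff_eq_zero hne)
  have h2 := hDx γ
  rw [hdeg, Nat.add_sub_cancel_left, pow_one] at h2
  simpa using add_mem h2 (coeff_prod_add_X_sub_mem P x hx.mem β γ)

/-- The graded ring of `R` at `P` is a polynomial ring in the local coordinates. -/
theorem IsLocalCoordinates.eq_zero_of_aeval_mem [Algebra.FormallySmooth k R] {P : Ideal R}
    (hP : P ≠ ⊤) {s : ℕ} {x : Fin s → R} (hx : IsLocalCoordinates k P x) {n : ℕ}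
    {F : MvPolynomial (Fin s) k} (hF : F.IsHomogeneous n) (h : aeval x F ∈ P ^ (n + 1)) :
    F = 0 := by
  ext β
  rw [coeff_zero]
  by_cases hβ : β.degree = n
  · subst hβ
    obtain ⟨D, hD, hDx⟩ := hx.exists_diffOp_coeff β
    have h1 := hD.map_pow_le P h
    rw [Nat.add_sub_cancel_left, pow_one] at h1
    have h2 : algebraMap k R (F.coeff β) ∈ P := by simpa using sub_mem h1 (hDx F hF)
    by_contra hne
    exact hP (Ideal.eq_top_of_isUnit_mem _ h2 ((IsUnit.mk0 _ hne).map _))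
  · exact hF.coeff_eq_zero hβ

/-- Differential operators of order at most `n` detect that the order of vanishing of `f` at `P`
is at most `n`. -/
theorem IsLocalCoordinates.exists_diffOp_notMem [Algebra.FormallySmooth k R] {P : Ideal R}
    (hP : P ≠ ⊤) (hev : ∃ ev : R →ₐ[k] k, ∀ r, r ∈ P ↔ ev r = 0) {s : ℕ} {x : Fin s → R}
    (hx : IsLocalCoordinates k P x) {n : ℕ} {f : R} (hf : f ∈ P ^ n) (hf' : f ∉ P ^ (n + 1)) :
    ∃ D : R →ₗ[k] R, IsDiffOp k R n D ∧ D f ∉ P := by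
  obtain ⟨F, hF, hfF⟩ := hx.exists_form hev hf
  have hF0 : F ≠ 0 := by
    rintro rfl
    exact hf' (by simpa using hfF)
  obtain ⟨β, hβ⟩ := ne_zero_iff.1 hF0
  have hdeg : β.degree = n := by
    by_contra hne
    exact hβ (hF.coeff_eq_zero hne)
  subst hdeg
  obtain ⟨D, hD, hDx⟩ := hx.exists_diffOp_coeff β
  refine ⟨D, hD, fun hmem => ?_⟩
  have h1 := hD.map_pow_le P hfF
  rw [Nat.add_sub_cancel_left, pow_one, map_sub] at h1
  have h2 : algebraMap k R (F.coeff β) ∈ P := by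
    have := sub_mem (sub_mem hmem h1) (hDx F hF)
    simpa using this
  exact hP (Ideal.eq_top_of_isUnit_mem _ h2 ((IsUnit.mk0 _ hβ).map _))

/-- The divided partial derivative `∂ ^ r / r! ∂ X_j ^ r` of polynomials in several variables. -/
noncomputable def MvPolynomial.partialHasseDeriv {s : ℕ} (j : Fin s) (r : ℕ) :
    MvPolynomial (Fin s) k →ₗ[k] MvPolynomial (Fin s) k :=
  (basisMonomials (Fin s) k).constr k fun γ =>
    monomial (γ - Finsupp.single j r) ((γ j).choose r : k)

theorem MvPolynomial.partialHasseDeriv_monomial {s : ℕ} (j : Fin s) (r : ℕ) (γ : Fin s →₀ ℕ)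
    (a : k) : partialHasseDeriv j r (monomial γ a) =
      monomial (γ - Finsupp.single j r) (a * (γ j).choose r) := by
  have h1 : monomial γ a = a • (basisMonomials (Fin s) k γ) := by
    simp [smul_monomial]
  rw [h1, map_smul, partialHasseDeriv, Module.Basis.constr_basis, smul_monomial, smul_eq_mul]

theorem MvPolynomial.coeff_partialHasseDeriv {s : ℕ} (j : Fin s) (r : ℕ)
    (F : MvPolynomial (Fin s) k) (δ : Fin s →₀ ℕ) : (partialHasseDeriv j r F).coeff δ =
      F.coeff (δ + Finsupp.single j r) * (δ j + r).choose r := by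
  classical
  induction F using MvPolynomial.induction_on' with
  | add p q hp hq => simp [hp, hq, add_mul]
  | monomial γ a =>
    rw [partialHasseDeriv_monomial, coeff_monomial, coeff_monomial]
    by_cases h : γ = δ + Finsupp.single j r
    · subst h
      simp
    · rw [if_neg h, zero_mul]
      split_ifs with h'
      · rw [Nat.choose_eq_zero_of_lt, Nat.cast_zero, mul_zero]
        by_contra hle
        apply h
        rw [← h', tsub_add_cancel_of_le]
        rw [Finsupp.single_le_iff]
        omega
      · rfl

theorem MvPolynomial.IsHomogeneous.partialHasseDeriv {s : ℕ} (j : Fin s) (r : ℕ) {n : ℕ}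
    {F : MvPolynomial (Fin s) k} (hF : F.IsHomogeneous (n + r)) :
    (MvPolynomial.partialHasseDeriv j r F).IsHomogeneous n := by
  intro δ hδ
  rw [coeff_partialHasseDeriv] at hδ
  have := hF (left_ne_zero_of_mul hδ)
  rw [Finsupp.weight_apply] at this ⊢
  rw [Finsupp.sum_fintype _ _ (by simp)] at this ⊢
  simp only [Finsupp.add_apply, Pi.one_apply, smul_eq_mul, mul_one, Finset.sum_add_distrib] at *
  have h1 : ∑ i, (Finsupp.single j r) i = r := by
    rw [Finset.sum_eq_single j] <;> simp +contextual [eq_comm]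
  omega

/-- A differential operator of order `r` which acts on forms in the local coordinates as the
divided partial derivative of order `r` in the direction `j`. -/
theorem IsLocalCoordinates.exists_diffOp_partialHasseDeriv [Algebra.FormallySmooth k R]
    {P : Ideal R} {s : ℕ} {x : Fin s → R} (hx : IsLocalCoordinates k P x) (j : Fin s) (r : ℕ) :
    ∃ D : R →ₗ[k] R, IsDiffOp k R r D ∧ ∀ (n : ℕ) (F : MvPolynomial (Fin s) k),
      F.IsHomogeneous (n + r) → D (aeval x F) - aeval x (partialHasseDeriv j r F) ∈
        P ^ (n + 1) := by
  classical
  obtain ⟨δ, hδ⟩ := hx.exists_derivation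
  obtain ⟨D, hD, hDx⟩ := exists_diffOp_taylor_coeff P x hx.mem δ hδ (Finsupp.single j r)
  rw [Finsupp.degree_single] at hD hDx
  refine ⟨D, hD, fun n F hF => ?_⟩
  have h1 : aeval x (partialHasseDeriv j r F) = ∑ γ ∈ F.support, F.coeff γ •
      coeff (Finsupp.single j r) (∏ i, (C (x i) + X i) ^ γ i) := by
    conv_lhs => rw [F.as_sum, map_sum, map_sum]
    refine Finset.sum_congr rfl fun γ _ => ?_
    rw [partialHasseDeriv_monomial, coeff_single_prod_add_X, aeval_monomial,
      Finsupp.prod_fintype _ _ (by simp), ← Finset.mul_prod_erase _ _ (Finset.mem_univ j),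
      map_mul, Algebra.smul_def, mul_assoc, map_natCast]
    congr 3
    · simp
    · refine Finset.prod_congr rfl fun i hi => ?_
      simp [Finset.ne_of_mem_erase hi]
  rw [map_aeval_eq_sum, h1, ← Finset.sum_sub_distrib]
  refine sum_mem fun γ hγ => ?_
  rw [← smul_sub]
  refine Submodule.smul_of_tower_mem _ _ ?_
  have hdeg : γ.degree = n + r := by
    by_contra hne
    exact mem_support_iff.1 hγ (hF.coeff_eq_zero hne)
  have h2 := hDx γ
  rw [hdeg] at h2
  convert h2 using 2
  omega

end

/-! ### The dimension of the cotangent space -/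

/-- The lowest homogeneous component of a nontrivial algebraic relation between local coordinates
would be a relation in the graded ring at `P`. -/
theorem IsLocalCoordinates.algebraicIndependent {k : Type u} {R : Type v} [Field k] [CommRing R]
    [Algebra k R] [Algebra.FormallySmooth k R] {P : Ideal R} (hP : P ≠ ⊤) {s : ℕ} {x : Fin s → R}
    (hx : IsLocalCoordinates k P x) : AlgebraicIndependent k x := by
  rw [algebraicIndependent_iff]
  intro F hF
  have key : ∀ n, homogeneousComponent n F = 0 := by
    intro n
    induction n using Nat.strong_induction_on with
    | _ n ih =>
      refine hx.eq_zero_of_aeval_mem hP (homogeneousComponent_isHomogeneous n F) ?_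
      have h1 : aeval x (homogeneousComponent n F) =
          - aeval x (F - homogeneousComponent n F) := by
        rw [map_sub, hF]
        ring
      rw [h1]
      refine neg_mem ?_
      rw [aeval_def, eval₂_eq']
      refine sum_mem fun γ hγ => Ideal.mul_mem_left _ _ ?_
      have hdeg : n + 1 ≤ γ.degree := by
        by_contra hlt
        rw [mem_support_iff, coeff_sub, coeff_homogeneousComponent] at hγ
        split_ifs at hγ with h
        · simp at hγ
        · have h2 := congrArg (coeff γ) (ih γ.degree (by omega))
          rw [coeff_homogeneousComponent, if_pos rfl] at h2
          simp [h2] at hγ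
      refine Ideal.pow_le_pow_right hdeg ?_
      rw [Finsupp.degree_eq_sum, ← Finset.prod_pow_eq_pow_sum]
      exact Ideal.prod_mem_prod fun i _ => Ideal.pow_mem_pow (hx.mem i) _
  rw [← sum_homogeneousComponent F]
  exact Finset.sum_eq_zero fun n _ => key n

theorem ringKrullDim_le_of_isIntegral {A B : Type*} [CommRing A] [CommRing B]
    [Algebra A B] [Algebra.IsIntegral A B] [FaithfulSMul A B] :
    ringKrullDim A ≤ ringKrullDim B := by
  refine iSup_le fun l => ?_
  obtain ⟨Q, hQ, hQl⟩ := Ideal.exists_ideal_over_prime_of_isIntegral (S := B) l.head.asIdeal ⊥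
    (by
      rw [← RingHom.ker_eq_comap_bot, (RingHom.injective_iff_ker_eq_bot _).1
        (FaithfulSMul.algebraMap_injective A B)]
      exact bot_le)
  obtain ⟨hQp, hQc⟩ := hQl
  have : Q.LiesOver l.head.asIdeal := ⟨hQc.symm⟩
  obtain ⟨L, hL, -, -⟩ := Ideal.exists_ltSeries_of_hasGoingUp l Q
  rw [← hL]
  exact le_iSup (fun L : LTSeries (PrimeSpectrum B) => (L.length : WithBot ℕ∞)) L

/-- Algebraically independent elements of a domain of finite type are at most as many as its Krull
dimension, by Noether normalization. -/
theorem AlgebraicIndependent.card_le_ringKrullDim {k : Type u} {R : Type v} [Field k] [CommRing R]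
    [IsDomain R] [Algebra k R] [Algebra.FiniteType k R] {d s : ℕ} (hd : ringKrullDim R = d)
    {x : Fin s → R} (hx : AlgebraicIndependent k x) : s ≤ d := by
  obtain ⟨m, g, hg, hint⟩ := exists_integral_inj_algHom_of_fg k R
  have hle : (m : WithBot ℕ∞) ≤ d := by
    let := g.toRingHom.toAlgebra
    have : Algebra.IsIntegral (MvPolynomial (Fin m) k) R := ⟨hint⟩
    have : FaithfulSMul (MvPolynomial (Fin m) k) R :=
      (faithfulSMul_iff_algebraMap_injective _ _).2 hg
    have h := ringKrullDim_le_of_isIntegral (A := MvPolynomial (Fin m) k) (B := R)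
    rw [hd, MvPolynomial.ringKrullDim_of_isNoetherianRing, ringKrullDim_eq_zero_of_field] at h
    simpa using h
  have hmd : m ≤ d := by exact_mod_cast hle
  refine le_trans ?_ hmd
  have halg : Algebra.IsAlgebraic (Algebra.adjoin k (Set.range fun i => g (X i))) R := by
    have hr : Algebra.adjoin k (Set.range fun i => g (X i)) = g.range := by
      rw [Algebra.adjoin_range_eq_range_aeval]
      congr 1
      exact (aeval_unique g).symm
    rw [hr]
    refine ⟨fun r => IsIntegral.isAlgebraic ?_⟩
    obtain ⟨q, hq, hqr⟩ := hint r
    refine ⟨q.map g.rangeRestrict.toRingHom, hq.map _, ?_⟩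
    rw [Polynomial.eval₂_map]
    exact hqr
  have h1 := hx.lift_cardinalMk_le_trdeg
  have h2 := Algebra.IsAlgebraic.trdeg_le_cardinalMk k (Set.range fun i => g (X i))
  have h3 := Cardinal.mk_range_le_lift (f := fun i : Fin m => g (X i))
  simp only [Cardinal.mk_fin, Cardinal.lift_natCast, Cardinal.lift_id'] at h1 h3
  exact_mod_cast (h1.trans h2).trans h3

theorem IsLocalCoordinates.le_ringKrullDim {k : Type u} {R : Type v} [Field k] [CommRing R]
    [IsDomain R] [Algebra k R] [Algebra.Smooth k R] {d : ℕ} (hd : ringKrullDim R = d)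
    {P : Ideal R} (hP : P ≠ ⊤) {s : ℕ} {x : Fin s → R} (hx : IsLocalCoordinates k P x) : s ≤ d :=
  (hx.algebraicIndependent hP).card_le_ringKrullDim hd

/-! ### Graded algebras of forms stable under divided partial derivatives -/

theorem Nat.Prime.not_dvd_choose_pow_log {p : ℕ} (hp : p.Prime) {a : ℕ} (ha : a ≠ 0) :
    ¬ p ∣ a.choose (p ^ Nat.log p a) := by
  have : Fact p.Prime := ⟨hp⟩
  have key : ∀ i a, a.choose (p ^ i) ≡ a / p ^ i [MOD p] := by
    intro i
    induction i with
    | zero => intro a; simp [Nat.ModEq.refl]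
    | succ i ih =>
      intro a
      have h := Choose.choose_modEq_choose_mod_mul_choose_div_nat (n := a) (k := p ^ (i + 1))
        (p := p)
      rw [Nat.pow_succ, Nat.mul_mod_left, Nat.choose_zero_right, one_mul,
        Nat.mul_div_cancel _ hp.pos] at h
      rw [Nat.pow_succ, mul_comm (p ^ i), ← Nat.div_div_eq_div_mul, mul_comm p]
      exact h.trans (ih _)
  rw [(key _ a).dvd_iff (dvd_refl p)]
  intro hdvd
  have h1 : 0 < a / p ^ Nat.log p a :=
    Nat.div_pos (Nat.pow_log_le_self p ha) (pow_pos hp.pos _)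
  have h2 : a / p ^ Nat.log p a < p := by
    rw [Nat.div_lt_iff_lt_mul (pow_pos hp.pos _), ← pow_succ']
    exact Nat.lt_pow_succ_log_self hp.one_lt a
  exact absurd (Nat.le_of_dvd h1 hdvd) (not_le.2 h2)

/-- The exponents `γ` of the monomials in the powers `X j ^ p ^ i` for `j < l i`, as far as
exponents `i ≤ e` matter: `p ^ (i + 1)` divides `γ j` as long as `j` is not below `l i`. -/
def adaptedExponents (p e : ℕ) (l : ℕ → ℕ) (s : ℕ) : Set (Fin s →₀ ℕ) :=
  {γ | ∀ i ≤ e, ∀ j : Fin s, l i ≤ j → p ^ (i + 1) ∣ γ j}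

section

variable {k : Type u} [Field k] {p e s : ℕ} {l : ℕ → ℕ}

theorem monomial_mem_of_mem_adaptedExponents (hp : p.Prime)
    (L : ℕ → Submodule k (MvPolynomial (Fin s) k)) (hone : 1 ∈ L 0)
    (hmul : ∀ m n F G, F ∈ L m → G ∈ L n → F * G ∈ L (m + n))
    (hpure : ∀ i ≤ e, ∀ j : Fin s, j < l i → X j ^ p ^ i ∈ L (p ^ i))
    {γ : Fin s →₀ ℕ} (hγ : γ ∈ adaptedExponents p e l s) (hdeg : γ.degree ≤ p ^ e) :
    monomial γ (1 : k) ∈ L γ.degree := by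
  classical
  have hpow : ∀ m F, F ∈ L m → ∀ c, F ^ c ∈ L (m * c) := by
    intro m F hF c
    induction c with
    | zero => simpa using hone
    | succ c ih =>
      rw [pow_succ, Nat.mul_succ]
      exact hmul _ _ _ _ ih hF
  have hprod : ∀ t : Finset (Fin s), (∀ j ∈ t, (X j ^ γ j : MvPolynomial (Fin s) k) ∈ L (γ j)) →
      ∏ j ∈ t, (X j ^ γ j : MvPolynomial (Fin s) k) ∈ L (∑ j ∈ t, γ j) := by
    intro t
    induction t using Finset.induction_on with
    | empty => simpa using hone
    | insert j t hj ih =>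
      intro h
      rw [Finset.prod_insert hj, Finset.sum_insert hj]
      exact hmul _ _ _ _ (h j (Finset.mem_insert_self ..))
        (ih fun i hi => h i (Finset.mem_insert_of_mem hi))
  rw [monomial_eq, Finsupp.prod_fintype _ _ (by simp), C_1, one_mul, Finsupp.degree_eq_sum]
  refine hprod _ fun j _ => ?_
  by_cases h0 : γ j = 0
  · simpa [h0] using hone
  have hje : (j : ℕ) < l e := by
    by_contra hle
    have h1 := Nat.le_of_dvd (Nat.pos_of_ne_zero h0) (hγ e le_rfl j (not_lt.1 hle))
    have h2 : γ j ≤ γ.degree := Finsupp.le_degree j γ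
    have h3 : p ^ e < p ^ (e + 1) := Nat.pow_lt_pow_right hp.one_lt (Nat.lt_succ_self e)
    omega
  have hex : ∃ i, (j : ℕ) < l i := ⟨e, hje⟩
  have hle : Nat.find hex ≤ e := Nat.find_min' hex hje
  have hdvd : p ^ Nat.find hex ∣ γ j := by
    rcases h : Nat.find hex with _ | i
    · simp
    · exact hγ i (by omega) j (not_lt.1 (Nat.find_min hex (by omega)))
  obtain ⟨c, hc⟩ := hdvd
  rw [hc, pow_mul]
  exact hpow _ _ (hpure _ hle j (Nat.find_spec hex)) c

/-- A graded algebra `L` of forms which is stable under the divided partial derivatives of order a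
power of `p` is generated by its additive elements `∑ j, v j * X j ^ p ^ i`. In coordinates adapted
to the flag of the spaces of additive elements, `L` is therefore spanned by monomials. -/
theorem mem_iff_support_subset_adaptedExponents (hp : p.Prime) [CharP k p] (hl : Monotone l)
    (L : ℕ → Submodule k (MvPolynomial (Fin s) k)) (hhom : ∀ n, ∀ F ∈ L n, F.IsHomogeneous n)
    (hone : 1 ∈ L 0) (hmul : ∀ m n F G, F ∈ L m → G ∈ L n → F * G ∈ L (m + n))
    (hderiv : ∀ (j : Fin s) (i n : ℕ), ∀ F ∈ L (n + p ^ i), partialHasseDeriv j (p ^ i) F ∈ L n)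
    (hpure : ∀ i ≤ e, ∀ v : Fin s → k, ∑ j, C (v j) * X j ^ p ^ i ∈ L (p ^ i) ↔
      ∀ j : Fin s, l i ≤ j → v j = 0)
    {n : ℕ} (hn : n ≤ p ^ e) (F : MvPolynomial (Fin s) k) :
    F ∈ L n ↔ F.IsHomogeneous n ∧ ∀ γ ∈ F.support, γ ∈ adaptedExponents p e l s := by
  classical
  have hmon : ∀ n ≤ p ^ e, ∀ γ ∈ adaptedExponents p e l s, γ.degree = n → ∀ c : k,
      monomial γ c ∈ L n := by
    rintro n hn γ hγ rfl c
    have h1 : monomial γ c = c • monomial γ (1 : k) := by simp [smul_monomial]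
    rw [h1]
    refine Submodule.smul_mem _ _ (monomial_mem_of_mem_adaptedExponents hp L hone hmul
      (fun i hi j hj => ?_) hγ hn)
    have h2 := (hpure i hi (Pi.single j 1)).2 fun j' hj' => by
      rw [Pi.single_apply, if_neg]
      rintro rfl
      omega
    rwa [Finset.sum_eq_single j (fun j' _ h => by simp [h]) (by simp),
      Pi.single_eq_same, C_1, one_mul] at h2
  refine ⟨fun hF => ⟨hhom n F hF, ?_⟩, fun ⟨hF, hs⟩ => ?_⟩
  swap
  · rw [F.as_sum]
    refine sum_mem fun γ hγ => hmon n hn γ (hs γ hγ) ?_ _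
    by_contra hne
    exact mem_support_iff.1 hγ (hF.coeff_eq_zero hne)
  induction n using Nat.strong_induction_on generalizing F with
  | _ n ih =>
    let F₁ := ∑ γ ∈ F.support with γ ∈ adaptedExponents p e l s, monomial γ (F.coeff γ)
    have hF₁ : F₁ ∈ L n := sum_mem fun γ hγ => by
      rw [Finset.mem_filter] at hγ
      refine hmon n hn γ hγ.2 ?_ _
      by_contra hne
      exact mem_support_iff.1 hγ.1 ((hhom n F hF).coeff_eq_zero hne)
    have hcoeff : ∀ γ, (F - F₁).coeff γ =
        if γ ∈ adaptedExponents p e l s then 0 else F.coeff γ := by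
      intro γ
      rw [coeff_sub, coeff_sum]
      simp only [coeff_monomial, Finset.sum_ite_eq', Finset.mem_filter, mem_support_iff]
      split_ifs with h1 h2 h2
      · simp
      · exact absurd h1.2 h2
      · by_cases h3 : F.coeff γ = 0
        · simp [h3]
        · exact absurd ⟨h3, h2⟩ h1
      · simp
    obtain ⟨F₂, hF₂⟩ : ∃ F₂, F₂ = F - F₁ := ⟨_, rfl⟩
    rw [← hF₂] at hcoeff
    have hF₂L : F₂ ∈ L n := hF₂ ▸ sub_mem hF hF₁
    -- With `p ^ r` the largest power of `p` not exceeding `γ j`, the binomial coefficient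
    -- `(γ j).choose (p ^ r)` is prime to `p`, so the divided derivative of order `p ^ r` does not
    -- kill the monomial `X ^ γ`; the exponent obtained from it is adapted by induction.
    have hstep : ∀ γ, F₂.coeff γ ≠ 0 → ∀ j, γ j ≠ 0 →
        γ - Finsupp.single j (p ^ Nat.log p (γ j)) ∈ adaptedExponents p e l s := by
      intro γ hγ j hj
      have hdeg : γ.degree = n := by
        by_contra hne
        exact hγ ((hhom n F₂ hF₂L).coeff_eq_zero hne)
      have h1 : p ^ Nat.log p (γ j) ≤ γ j := Nat.pow_log_le_self p hj
      have h2 : γ j ≤ γ.degree := Finsupp.le_degree j γ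
      have h3 : 0 < p ^ Nat.log p (γ j) := pow_pos hp.pos _
      have h4 : n - p ^ Nat.log p (γ j) + p ^ Nat.log p (γ j) = n := by omega
      refine ih (n - p ^ Nat.log p (γ j)) (by omega) (by omega) _
        (hderiv j _ _ F₂ (by rwa [h4])) _ ?_
      rw [mem_support_iff, coeff_partialHasseDeriv, tsub_add_cancel_of_le
        (Finsupp.single_le_iff.2 h1)]
      refine mul_ne_zero hγ ?_
      rw [Finsupp.tsub_apply, Finsupp.single_eq_same, Nat.sub_add_cancel h1, Ne,
        CharP.cast_eq_zero_iff k p]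
      exact hp.not_dvd_choose_pow_log hj
    have hsingle : ∀ γ, F₂.coeff γ ≠ 0 → ∃ i ≤ e, ∃ j : Fin s, l i ≤ j ∧ n = p ^ i ∧
        γ = Finsupp.single j (p ^ i) := by
      intro γ hγ
      have hdeg : γ.degree = n := by
        by_contra hne
        exact hγ ((hhom n F₂ hF₂L).coeff_eq_zero hne)
      have hnot : γ ∉ adaptedExponents p e l s := fun h => hγ (by rw [hcoeff, if_pos h])
      simp only [adaptedExponents, Set.mem_ofPred_eq, not_forall] at hnot
      obtain ⟨i₀, hi₀, j₀, hj₀, hnd⟩ := hnot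
      have h0 : γ j₀ ≠ 0 := fun h => hnd (by simp [h])
      have h1 : p ^ Nat.log p (γ j₀) ≤ γ j₀ := Nat.pow_log_le_self p h0
      have h2 := hstep γ hγ j₀ h0 i₀ hi₀ j₀ hj₀
      rw [Finsupp.tsub_apply, Finsupp.single_eq_same] at h2
      have hlog : Nat.log p (γ j₀) ≤ i₀ := by
        by_contra hlt
        have h3 : p ^ (i₀ + 1) ∣ p ^ Nat.log p (γ j₀) := pow_dvd_pow p (by omega)
        exact hnd ((Nat.dvd_sub_iff_left h1 h3).1 h2)
      have heq : γ j₀ = p ^ Nat.log p (γ j₀) := by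
        have h3 : γ j₀ < p ^ (i₀ + 1) :=
          (Nat.lt_pow_succ_log_self hp.one_lt _).trans_le
            (Nat.pow_le_pow_right hp.pos (by omega))
        have h4 := Nat.eq_zero_of_dvd_of_lt h2 (by omega)
        omega
      have hγe : γ = Finsupp.single j₀ (p ^ Nat.log p (γ j₀)) := by
        ext j
        by_cases hj : j = j₀
        · subst hj
          rw [Finsupp.single_eq_same]
          exact heq
        · rw [Finsupp.single_eq_of_ne hj]
          by_contra hne
          have h3 := hstep γ hγ j hne i₀ hi₀ j₀ hj₀
          rw [Finsupp.tsub_apply, Finsupp.single_eq_of_ne (Ne.symm hj), tsub_zero] at h3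
          exact hnd h3
      refine ⟨Nat.log p (γ j₀), by omega, j₀, (hl hlog).trans hj₀, ?_, hγe⟩
      rw [← hdeg]
      conv_lhs => rw [hγe]
      rw [Finsupp.degree_single]
    have hF₂0 : F₂ = 0 := by
      by_contra hne
      obtain ⟨γ, hγ⟩ := ne_zero_iff.1 hne
      obtain ⟨i, hi, j, hj, hni, rfl⟩ := hsingle γ hγ
      have hsum : F₂ = ∑ j, C (F₂.coeff (Finsupp.single j (p ^ i))) * X j ^ p ^ i := by
        ext δ
        rw [coeff_sum]
        simp only [coeff_C_mul, coeff_X_pow]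
        by_cases hδ : F₂.coeff δ = 0
        · rw [hδ, Finset.sum_eq_zero]
          intro j' _
          split_ifs with h
          · rw [h, hδ, zero_mul]
          · rw [mul_zero]
        · obtain ⟨i', -, j', -, hni', rfl⟩ := hsingle δ hδ
          rw [← hni', ← hni, Finset.sum_eq_single j']
          · simp
          · intro j'' _ hne''
            rw [if_neg, mul_zero]
            rw [Finsupp.single_left_inj]
            · exact hne''
            · rw [hni]
              exact (pow_pos hp.pos _).ne'
          · simp
      rw [hsum, hni] at hF₂L
      exact hγ ((hpure i hi _).1 hF₂L j hj)
    intro γ hγ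
    by_contra hnot
    have := hcoeff γ
    rw [if_neg hnot, hF₂0, coeff_zero] at this
    exact mem_support_iff.1 hγ this.symm

end

/-! ### Dimension count and adapted bases -/

/-- When the positions `l i` for `i < e` are fixed, the number of adapted exponents of degree
`p ^ e` strictly increases with `l e`. -/
theorem ncard_adaptedExponents_lt {p : ℕ} (hp : p.Prime) {e s s' : ℕ} {l l' : ℕ → ℕ}
    (hlt : l e < l' e) (heq : ∀ i < e, l i = l' i) (hs : l e ≤ s) (hs' : l' e ≤ s') :
    {γ | γ ∈ adaptedExponents p e l s ∧ γ.degree = p ^ e}.ncard <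
      {γ | γ ∈ adaptedExponents p e l' s' ∧ γ.degree = p ^ e}.ncard := by
  classical
  -- Adapted exponents of degree `p ^ e` vanish from position `l e` on, so they may be viewed as
  -- sequences indexed by `ℕ`, independently of the number `s` of variables.
  let E : (ℕ → ℕ) → Set (ℕ →₀ ℕ) := fun l =>
    {g | (∀ i ≤ e, ∀ j, l i ≤ j → p ^ (i + 1) ∣ g j) ∧ g.degree = p ^ e}
  have hvanish : ∀ (l : ℕ → ℕ), ∀ g ∈ E l, ∀ j, l e ≤ j → g j = 0 := by
    intro l g hg j hj
    refine Nat.eq_zero_of_dvd_of_lt (hg.1 e le_rfl j hj) ?_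
    have h1 : g j ≤ g.degree := Finsupp.le_degree j g
    have h2 : p ^ e < p ^ (e + 1) := Nat.pow_lt_pow_right hp.one_lt (Nat.lt_succ_self e)
    have h3 := hg.2
    omega
  have hcard : ∀ (l : ℕ → ℕ) (s : ℕ), l e ≤ s →
      {γ | γ ∈ adaptedExponents p e l s ∧ γ.degree = p ^ e}.ncard = (E l).ncard := by
    intro l s hs
    have hdeg : ∀ γ : Fin s →₀ ℕ, (γ.mapDomain Fin.val).degree = γ.degree :=
      fun γ => Finsupp.degree_mapDomain _ γ
    rw [← Set.ncard_image_of_injective _ (Finsupp.mapDomain_injective (M := ℕ) Fin.val_injective)]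
    congr 1
    ext g
    constructor
    · rintro ⟨γ, ⟨hγ, hγd⟩, rfl⟩
      refine ⟨fun i hi j hj => ?_, by rw [hdeg, hγd]⟩
      by_cases hjs : j < s
      · have := Finsupp.mapDomain_apply Fin.val_injective γ (⟨j, hjs⟩ : Fin s)
        simp only at this
        rw [this]
        exact hγ i hi _ hj
      · rw [Finsupp.mapDomain_of_notMem_range]
        · exact dvd_zero _
        · rintro ⟨a, rfl⟩
          exact hjs a.2
    · intro hg
      have hmap : (g.comapDomain (Fin.val : Fin s → ℕ) Fin.val_injective.injOn).mapDomain
          Fin.val = g := by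
        refine Finsupp.mapDomain_comapDomain (Fin.val : Fin s → ℕ) Fin.val_injective g
          fun j hj => ?_
        have : j < s := by
          by_contra hle
          exact Finsupp.mem_support_iff.1 hj (hvanish l g hg j (by omega))
        exact ⟨⟨j, this⟩, rfl⟩
      refine ⟨_, ⟨fun i hi j hj => ?_, ?_⟩, hmap⟩
      · rw [Finsupp.comapDomain_apply]
        exact hg.1 i hi _ hj
      · rw [← hdeg, hmap]
        exact hg.2
  rw [hcard l s hs, hcard l' s' hs']
  have hfin : (E l').Finite := by
    refine Set.Finite.of_injOn (f := fun g : ℕ →₀ ℕ => fun j : Fin (l' e) => g j)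
      (t := Set.Iic fun _ => p ^ e) (fun g hg j => ?_) (fun g hg g' hg' h => ?_)
      (Set.finite_Iic _)
    · exact (Finsupp.le_degree _ g).trans hg.2.le
    · ext j
      by_cases hj : j < l' e
      · exact congrFun h ⟨j, hj⟩
      · rw [hvanish l' g hg j (not_lt.1 hj), hvanish l' g' hg' j (not_lt.1 hj)]
  refine Set.ncard_lt_ncard ?_ hfin
  rw [Set.ssubset_iff_of_subset]
  · refine ⟨Finsupp.single (l e) (p ^ e), ⟨fun i hi j hj => ?_, by simp⟩, fun h => ?_⟩
    · rw [Finsupp.single_apply]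
      split_ifs with h
      · subst h
        rcases hi.lt_or_eq with h | rfl
        · exact pow_dvd_pow p h
        · omega
      · exact dvd_zero _
    · have := hvanish l _ h (l e) le_rfl
      rw [Finsupp.single_eq_same] at this
      exact (pow_pos hp.pos e).ne' this
  · refine fun g hg => ⟨fun i hi j hj => ?_, hg.2⟩
    rcases hi.lt_or_eq with h | rfl
    · exact hg.1 i hi j (by rw [heq i h]; exact hj)
    · exact hg.1 i hi j (by omega)

/-- A flag in a finite-dimensional vector space has an adapted basis. -/
theorem exists_basis_adapted {k : Type*} [Field k] {s : ℕ} (W : ℕ → Submodule k (Fin s → k))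
    (hW : Monotone W) (e : ℕ) : ∃ b : Module.Basis (Fin s) k (Fin s → k), ∀ i ≤ e, ∀ v,
      v ∈ W i ↔ ∀ j : Fin s, Module.finrank k (W i) ≤ j → b.repr v j = 0 := by
  classical
  have key : ∀ (W : ℕ → Submodule k (Fin s → k)), Monotone W → ∀ n, ∃ b : ℕ → Fin s → k,
      ∀ i ≤ n, Submodule.span k (b '' Set.Iio (Module.finrank k (W i))) = W i := by
    have extend : ∀ U U' : Submodule k (Fin s → k), U ≤ U' → ∀ b : ℕ → Fin s → k,
        Submodule.span k (b '' Set.Iio (Module.finrank k U)) = U → ∃ b' : ℕ → Fin s → k,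
        (∀ j < Module.finrank k U, b' j = b j) ∧
        Submodule.span k (b' '' Set.Iio (Module.finrank k U')) = U' := by
      intro U U' hUU b hb
      obtain ⟨C, hC⟩ := Submodule.exists_isCompl (U.comap U'.subtype)
      have hrank : Module.finrank k U + Module.finrank k C = Module.finrank k U' := by
        rw [← Submodule.finrank_add_eq_of_isCompl hC,
          (Submodule.comapSubtypeEquivOfLe hUU).finrank_eq]
      have : Module.Free k C := Module.Free.of_divisionRing k C
      let c := Module.finBasis k C
      refine ⟨fun j => if h : j - Module.finrank k U < Module.finrank k C then
        if j < Module.finrank k U then b j else (c ⟨_, h⟩ : U') else b j, fun j hj => ?_, ?_⟩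
      · simp only [if_pos hj, dite_eq_ite, ite_self]
      · have h1 : Set.Iio (Module.finrank k U') =
            Set.Iio (Module.finrank k U) ∪ Set.Ico (Module.finrank k U) (Module.finrank k U') := by
          ext j
          simp only [Set.mem_Iio, Set.mem_union, Set.mem_Ico]
          omega
        rw [h1, Set.image_union, Submodule.span_union]
        have h2 : ∀ b', (∀ j < Module.finrank k U, b' j = b j) →
            b' '' Set.Iio (Module.finrank k U) = b '' Set.Iio (Module.finrank k U) :=
          fun b' h => Set.image_congr fun j hj => h j hj
        rw [h2 _ (fun j hj => by simp only [if_pos hj, dite_eq_ite, ite_self]), hb]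
        have h3 : (fun j => if h : j - Module.finrank k U < Module.finrank k C then
            if j < Module.finrank k U then b j else ((c ⟨_, h⟩ : U') : Fin s → k) else b j) ''
            Set.Ico (Module.finrank k U) (Module.finrank k U') =
            U'.subtype '' (C.subtype '' Set.range c) := by
          ext v
          constructor
          · rintro ⟨j, ⟨hj1, hj2⟩, rfl⟩
            have h : j - Module.finrank k U < Module.finrank k C := by omega
            simp only [dif_pos h, if_neg (not_lt.2 hj1)]
            exact ⟨_, ⟨_, ⟨_, rfl⟩, rfl⟩, rfl⟩
          · rintro ⟨_, ⟨_, ⟨j, rfl⟩, rfl⟩, rfl⟩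
            refine ⟨Module.finrank k U + j, ⟨by omega, by omega⟩, ?_⟩
            have h : Module.finrank k U + j - Module.finrank k U < Module.finrank k C := by omega
            simp only [dif_pos h,
              if_neg (show ¬ Module.finrank k U + j < Module.finrank k U by omega)]
            simp
        rw [h3, ← Submodule.map_span, ← Submodule.map_span, c.span_eq, Submodule.map_top,
          Submodule.range_subtype]
        have h4 : U = (U.comap U'.subtype).map U'.subtype := by
          rw [Submodule.map_comap_subtype, inf_eq_right.2 hUU]
        conv_lhs => rw [h4]
        rw [← Submodule.map_sup, hC.sup_eq_top, Submodule.map_top, Submodule.range_subtype]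
    intro W hW n
    induction n with
    | zero =>
      obtain ⟨b, -, hb⟩ := extend ⊥ (W 0) bot_le 0 (by simp)
      exact ⟨b, fun i hi => by rwa [Nat.le_zero.1 hi]⟩
    | succ n ih =>
      obtain ⟨b, hb⟩ := ih
      obtain ⟨b', hb', hbs⟩ := extend (W n) (W (n + 1)) (hW n.le_succ) b (hb n le_rfl)
      refine ⟨b', fun i hi => ?_⟩
      rcases hi.lt_or_eq with h | rfl
      · refine Eq.trans ?_ (hb i (by omega))
        congr 1
        exact Set.image_congr fun j hj =>
          hb' j (lt_of_lt_of_le hj (Submodule.finrank_mono (hW (by omega))))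
      · exact hbs
  obtain ⟨W', hW', hWe, hWtop⟩ : ∃ W' : ℕ → Submodule k (Fin s → k), Monotone W' ∧
      (∀ i ≤ e, W' i = W i) ∧ W' (e + 1) = ⊤ := by
    refine ⟨fun i => if i ≤ e then W i else ⊤, fun i j hij => ?_, fun i hi => if_pos hi,
      if_neg (by omega)⟩
    by_cases hj : j ≤ e
    · simpa [hj, hij.trans hj] using hW hij
    · simp [hj]
  obtain ⟨b, hb⟩ := key W' hW' (e + 1)
  have himage : ∀ n ≤ s, (fun j : Fin s => b j) '' {j | (j : ℕ) < n} = b '' Set.Iio n := by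
    intro n hn
    ext v
    constructor
    · rintro ⟨j, hj, rfl⟩
      exact ⟨j, hj, rfl⟩
    · rintro ⟨j, hj, rfl⟩
      exact ⟨⟨j, lt_of_lt_of_le hj hn⟩, hj, rfl⟩
  have htop : ⊤ ≤ Submodule.span k (Set.range fun j : Fin s => b j) := by
    have h1 := hb (e + 1) le_rfl
    rw [hWtop, finrank_top, Module.finrank_fin_fun] at h1
    rw [← h1, ← himage s le_rfl]
    exact Submodule.span_mono (Set.image_subset_range _ _)
  let β := basisOfTopLeSpanOfCardEqFinrank _ htop (by simp)
  refine ⟨β, fun i hi v => ?_⟩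
  have h1 := hb i (by omega)
  rw [hWe i hi] at h1
  have hle : Module.finrank k (W i) ≤ s := by
    simpa using Submodule.finrank_le (W i)
  have h2 : (β : Fin s → Fin s → k) = fun j : Fin s => b j :=
    coe_basisOfTopLeSpanOfCardEqFinrank _ _ _
  rw [← himage _ hle, ← h2] at h1
  conv_lhs => rw [← h1]
  rw [Module.Basis.mem_span_image]
  constructor
  · intro h j hj
    by_contra hne
    exact absurd (h (Finsupp.mem_support_iff.2 hne)) (not_lt.2 hj)
  · intro h j hj
    by_contra hne
    exact Finsupp.mem_support_iff.1 hj (h j (not_lt.1 hne))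

/-! ### Differential operators as functionals on forms -/

theorem IsDiffOp.add {k : Type u} {R : Type v} [CommRing k] [CommRing R] [Algebra k R] {n : ℕ}
    {D E : R →ₗ[k] R} (hD : IsDiffOp k R n D) (hE : IsDiffOp k R n E) :
    IsDiffOp k R n (D + E) := by
  have h : ∀ (D E : R →ₗ[k] R) r, (D + E) ∘ₗ LinearMap.mulLeft k r -
      LinearMap.mulLeft k r ∘ₗ (D + E) = (D ∘ₗ LinearMap.mulLeft k r -
      LinearMap.mulLeft k r ∘ₗ D) + (E ∘ₗ LinearMap.mulLeft k r - LinearMap.mulLeft k r ∘ₗ E) := by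
    intro D E r
    ext f
    simp
    ring
  induction n generalizing D E with
  | zero =>
    intro r
    rw [h, hD r, hE r, add_zero]
  | succ n ih =>
    intro r
    rw [h]
    exact ih (hD r) (hE r)

theorem IsDiffOp.smul {k : Type u} {R : Type v} [CommRing k] [CommRing R] [Algebra k R] {n : ℕ}
    {D : R →ₗ[k] R} (hD : IsDiffOp k R n D) (c : k) : IsDiffOp k R n (c • D) := by
  have h : ∀ (D : R →ₗ[k] R) r, (c • D) ∘ₗ LinearMap.mulLeft k r -
      LinearMap.mulLeft k r ∘ₗ (c • D) = c • (D ∘ₗ LinearMap.mulLeft k r -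
      LinearMap.mulLeft k r ∘ₗ D) := by
    intro D r
    ext f
    simp [smul_sub]
  induction n generalizing D with
  | zero =>
    intro r
    rw [h, hD r, smul_zero]
  | succ n ih =>
    intro r
    rw [h]
    exact ih (hD r)

theorem IsDiffOp.sum {k : Type u} {R : Type v} [CommRing k] [CommRing R] [Algebra k R] {n : ℕ}
    {ι : Type*} (t : Finset ι) {D : ι → R →ₗ[k] R} (hD : ∀ i ∈ t, IsDiffOp k R n (D i)) :
    IsDiffOp k R n (∑ i ∈ t, D i) := by
  classical
  induction t using Finset.induction_on with
  | empty =>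
    rw [Finset.sum_empty]
    clear hD
    induction n with
    | zero => intro r; simp
    | succ n ih => intro r; simpa using ih
  | insert i t hi ih =>
    rw [Finset.sum_insert hi]
    exact (hD i (Finset.mem_insert_self ..)).add (ih fun j hj => hD j (Finset.mem_insert_of_mem hj))

section

variable {k : Type u} {R : Type v} [Field k] [CommRing R] [Algebra k R]

/-- Every linear functional on forms of degree `n` in the local coordinates is realized by a
differential operator of order at most `n`. -/
theorem IsLocalCoordinates.exists_diffOp_functional [Algebra.FormallySmooth k R] {P : Ideal R}
    {s : ℕ} {x : Fin s → R} (hx : IsLocalCoordinates k P x) (n : ℕ)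
    (φ : MvPolynomial (Fin s) k →ₗ[k] k) :
    ∃ D : R →ₗ[k] R, IsDiffOp k R n D ∧ ∀ F : MvPolynomial (Fin s) k,
      F.IsHomogeneous n → D (aeval x F) - algebraMap k R (φ F) ∈ P := by
  classical
  choose D hD hDx using fun β => hx.exists_diffOp_coeff β
  let t : Finset (Fin s →₀ ℕ) := Finset.finsuppAntidiag Finset.univ n
  have ht : ∀ β, β ∈ t ↔ β.degree = n := by
    intro β
    simp [t, Finset.mem_finsuppAntidiag, Finsupp.degree_eq_sum]
  refine ⟨∑ β ∈ t, φ (monomial β 1) • D β, IsDiffOp.sum t fun β hβ => ?_, fun F hF => ?_⟩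
  · have := (hD β).smul (φ (monomial β 1))
    rwa [(ht β).1 hβ] at this
  · have h1 : algebraMap k R (φ F) =
        ∑ β ∈ t, φ (monomial β 1) • algebraMap k R (F.coeff β) := by
      have h2 : F = ∑ β ∈ t, F.coeff β • monomial β 1 := by
        ext γ
        simp only [coeff_sum, coeff_smul, coeff_monomial, smul_eq_mul, mul_ite, mul_one, mul_zero,
          Finset.sum_ite_eq', ht]
        split_ifs with h
        · rfl
        · exact hF.coeff_eq_zero h
      conv_lhs => rw [h2, map_sum, map_sum]
      refine Finset.sum_congr rfl fun β _ => ?_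
      rw [map_smul, smul_eq_mul, map_mul, mul_comm, Algebra.smul_def (φ _)]
    rw [h1, LinearMap.sum_apply, ← Finset.sum_sub_distrib]
    refine sum_mem fun β hβ => ?_
    rw [LinearMap.smul_apply, ← smul_sub]
    exact Submodule.smul_of_tower_mem P _ (hDx β F (by rwa [(ht β).1 hβ]))

/-- If the matrix `M` is invertible at the point `P`, it has no kernel modulo `P` in `k ^ n`. -/
theorem eq_zero_of_det_notMem {P : Ideal R} [P.IsPrime] {n : ℕ} {M : Matrix (Fin n) (Fin n) R}
    (hM : M.det ∉ P) {c : Fin n → k} (hc : ∀ i, ∑ j, c j • M i j ∈ P) : c = 0 := by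
  let c' : Fin n → R := fun j => algebraMap k R (c j)
  have h1 : ∀ i, (M.mulVec c') i ∈ P := by
    intro i
    have := hc i
    simpa [Matrix.mulVec, dotProduct, c', Algebra.smul_def, mul_comm] using this
  have h2 : ∀ j, M.det * c' j ∈ P := by
    intro j
    have h3 : M.det * c' j = (M.adjugate.mulVec (M.mulVec c')) j := by
      rw [Matrix.mulVec_mulVec, Matrix.adjugate_mul, Matrix.smul_mulVec, Matrix.one_mulVec]
      rfl
    rw [h3, Matrix.mulVec, dotProduct]
    exact sum_mem fun i _ => Ideal.mul_mem_left _ _ (h1 i)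
  ext j
  by_contra hne
  have h4 := ((‹P.IsPrime›.mem_or_mem (h2 j)).resolve_left hM)
  exact ‹P.IsPrime›.ne_top (Ideal.eq_top_of_isUnit_mem _ h4 ((IsUnit.mk0 _ hne).map _))

theorem det_notMem_of_sub_one_mem {P : Ideal R} (hP : P ≠ ⊤) {n : ℕ}
    {M : Matrix (Fin n) (Fin n) R} (hM : ∀ i j, M i j - (if i = j then 1 else 0) ∈ P) :
    M.det ∉ P := by
  intro h
  rw [← Ideal.Quotient.eq_zero_iff_mem, RingHom.map_det] at h
  have h1 : (Ideal.Quotient.mk P).mapMatrix M = 1 := by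
    ext i j
    have := hM i j
    rw [← Ideal.Quotient.eq] at this
    rw [RingHom.mapMatrix_apply, Matrix.map_apply, this, Matrix.one_apply]
    split_ifs <;> simp
  rw [h1, Matrix.det_one] at h
  have := Ideal.Quotient.nontrivial_iff.2 hP
  exact one_ne_zero h

/-- The dimension of the cotangent space is lower semi-continuous. -/
theorem IsLocalCoordinates.exists_notMem_forall_le {P₀ : Ideal R} (hP₀ : P₀ ≠ ⊤)
    {s₀ : ℕ} {x₀ : Fin s₀ → R} (hx₀ : IsLocalCoordinates k P₀ x₀) :
    ∃ g ∉ P₀, ∀ P : Ideal R, P.IsPrime → (∃ ev : R →ₐ[k] k, ∀ r, r ∈ P ↔ ev r = 0) → g ∉ P →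
      ∀ (s : ℕ) (x : Fin s → R), IsLocalCoordinates k P x → s₀ ≤ s := by
  obtain ⟨δ, hδ⟩ := hx₀.exists_derivation
  refine ⟨Matrix.det (Matrix.of fun i j => δ i (x₀ j)), det_notMem_of_sub_one_mem hP₀ hδ,
    fun P hP hev hg s x hx => ?_⟩
  obtain ⟨ev, hev⟩ := hev
  choose A hA using fun j => hx.exists_linear (x₀ j - algebraMap k R (ev (x₀ j))) (by simp [hev])
  let T : (Fin s₀ → k) →ₗ[k] (Fin s → k) := Fintype.linearCombination k A
  have hT : Function.Injective T := by
    rw [← LinearMap.ker_eq_bot, LinearMap.ker_eq_bot']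
    intro c hc
    refine eq_zero_of_det_notMem hg fun i => ?_
    have h1 : ∑ j, c j • (x₀ j - algebraMap k R (ev (x₀ j))) ∈ P ^ 2 := by
      have h2 : ∑ j, c j • ∑ m, A j m • x m = 0 := by
        simp_rw [Finset.smul_sum, smul_smul]
        rw [Finset.sum_comm]
        refine Finset.sum_eq_zero fun m _ => ?_
        rw [← Finset.sum_smul]
        have h3 := congrFun hc m
        simp only [T, Fintype.linearCombination_apply, Finset.sum_apply, Pi.smul_apply,
          smul_eq_mul, Pi.zero_apply] at h3
        rw [h3, zero_smul]
      have h4 : ∑ j, c j • (x₀ j - algebraMap k R (ev (x₀ j)) - ∑ m, A j m • x m) ∈ P ^ 2 :=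
        sum_mem fun j _ => Submodule.smul_of_tower_mem _ _ (hA j)
      simp only [smul_sub, Finset.sum_sub_distrib] at h4 ⊢
      simpa [h2] using h4
    have h5 : ∀ y ∈ P ^ 2, δ i y ∈ P := by
      intro y hy
      rw [pow_two] at hy
      refine Submodule.mul_induction_on hy (fun a ha b hb => ?_) (fun a b ha hb => ?_)
      · rw [Derivation.leibniz]
        exact add_mem (Ideal.mul_mem_right _ _ ha) (Ideal.mul_mem_right _ _ hb)
      · rw [map_add]
        exact add_mem ha hb
    simpa using h5 _ h1
  simpa using LinearMap.finrank_le_finrank_of_injective hT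

end

/-! ### The leading forms of an idealistic filtration -/

namespace IdealisticFiltration

variable {k : Type u} {R : Type v} [Field k] [CommRing R] [Algebra k R]

theorem pow_mem_level (I : IdealisticFiltration R) {a : ℝ} {f : R} (hf : f ∈ I.level a) (n : ℕ) :
    f ^ n ∈ I.level (n * a) := by
  induction n with
  | zero => simp [I.level_zero]
  | succ n ih =>
    have h := I.level_mul_le _ _ (Ideal.mul_mem_mul ih hf)
    rw [pow_succ]
    convert h using 2
    push_cast
    ring

/-- The leading algebra in degree `n`, in terms of local coordinates `x` at `P`: the forms of
degree `n` which are leading forms at `P` of elements at level `n`. -/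
def formSpace (I : IdealisticFiltration R) (P : Ideal R) {s : ℕ} (x : Fin s → R) (n : ℕ) :
    Submodule k (MvPolynomial (Fin s) k) where
  carrier := {F | F.IsHomogeneous n ∧ ∃ f ∈ I.level n, f - aeval x F ∈ P ^ (n + 1)}
  zero_mem' := ⟨isHomogeneous_zero _ _ _, 0, zero_mem _, by simp⟩
  add_mem' := by
    rintro F G ⟨hF, f, hf, hfF⟩ ⟨hG, g, hg, hgG⟩
    refine ⟨hF.add hG, f + g, add_mem hf hg, ?_⟩
    rw [map_add, add_sub_add_comm]
    exact add_mem hfF hgG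
  smul_mem' := by
    rintro c F ⟨hF, f, hf, hfF⟩
    refine ⟨?_, c • f, Submodule.smul_of_tower_mem _ _ hf, ?_⟩
    · rw [smul_eq_C_mul]
      exact hF.C_mul c
    · rw [map_smul, ← smul_sub]
      exact Submodule.smul_of_tower_mem _ _ hfF

/-- The pure part of the leading algebra in degree `p ^ e`, in terms of local coordinates `x` at
`P`: the vectors `v` such that `(∑ i, v i • x i) ^ p ^ e` is the leading form at `P` of an element
at level `p ^ e`. -/
def pureVectors [Nontrivial R] [IsAlgClosed k] (p : ℕ) [ExpChar k p] (I : IdealisticFiltration R)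
    (P : Ideal R) {s : ℕ} (x : Fin s → R) (e : ℕ) : Submodule k (Fin s → k) where
  carrier := {v | ∃ f ∈ I.level (p ^ e : ℕ), f - (∑ i, v i • x i) ^ p ^ e ∈ P ^ (p ^ e + 1)}
  zero_mem' := ⟨0, zero_mem _, by simp [zero_pow (pow_ne_zero e (expChar_pos k p).ne')]⟩
  add_mem' := by
    have : ExpChar R p := expChar_of_injective_algebraMap (algebraMap k R).injective p
    rintro v w ⟨f, hf, hfv⟩ ⟨g, hg, hgw⟩
    refine ⟨f + g, add_mem hf hg, ?_⟩
    simp only [Pi.add_apply, add_smul, Finset.sum_add_distrib]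
    rw [add_pow_expChar_pow, add_sub_add_comm]
    exact add_mem hfv hgw
  smul_mem' := by
    rintro c v ⟨f, hf, hfv⟩
    refine ⟨c ^ p ^ e • f, Submodule.smul_of_tower_mem _ _ hf, ?_⟩
    simp only [Pi.smul_apply, smul_assoc]
    rw [← Finset.smul_sum, smul_pow, ← smul_sub]
    exact Submodule.smul_of_tower_mem _ _ hfv

theorem mem_formSpace {I : IdealisticFiltration R} {P : Ideal R} {s : ℕ} {x : Fin s → R} {n : ℕ}
    {F : MvPolynomial (Fin s) k} : F ∈ I.formSpace P x n ↔
      F.IsHomogeneous n ∧ ∃ f ∈ I.level n, f - aeval x F ∈ P ^ (n + 1) := Iff.rfl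

theorem one_mem_formSpace (I : IdealisticFiltration R) (P : Ideal R) {s : ℕ} (x : Fin s → R) :
    (1 : MvPolynomial (Fin s) k) ∈ I.formSpace P x 0 :=
  ⟨isHomogeneous_one _ _, 1, by simp [I.level_zero], by simp⟩

theorem mul_mem_formSpace (I : IdealisticFiltration R) {P : Ideal R} {s : ℕ} {x : Fin s → R}
    (hx : ∀ i, x i ∈ P) (m n : ℕ) (F G : MvPolynomial (Fin s) k) (hF : F ∈ I.formSpace P x m)
    (hG : G ∈ I.formSpace P x n) : F * G ∈ I.formSpace P x (m + n) := by
  obtain ⟨hF, f, hf, hfF⟩ := hF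
  obtain ⟨hG, g, hg, hgG⟩ := hG
  refine ⟨hF.mul hG, f * g, ?_, ?_⟩
  · rw [Nat.cast_add]
    exact I.level_mul_le _ _ (Ideal.mul_mem_mul hf hg)
  · have h1 : f * g - aeval x (F * G) =
        (f - aeval x F) * (g - aeval x G) + (f - aeval x F) * aeval x G +
          aeval x F * (g - aeval x G) := by
      rw [map_mul]
      ring
    have hF' := aeval_mem_pow_of_isHomogeneous hx hF
    have hG' := aeval_mem_pow_of_isHomogeneous hx hG
    have mem : ∀ {a b : ℕ} {y z : R}, y ∈ P ^ a → z ∈ P ^ b → m + n + 1 ≤ a + b →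
        y * z ∈ P ^ (m + n + 1) := fun hy hz h =>
      Ideal.pow_le_pow_right h (by rw [pow_add]; exact Ideal.mul_mem_mul hy hz)
    rw [h1]
    exact add_mem (add_mem (mem hfF hgG (by omega)) (mem hfF hG' (by omega)))
      (mem hF' hgG (by omega))

theorem partialHasseDeriv_mem_formSpace [Algebra.FormallySmooth k R] {I : IdealisticFiltration R}
    (hI : I.IsDSaturated k) {P : Ideal R} {s : ℕ} {x : Fin s → R} (hx : IsLocalCoordinates k P x)
    (j : Fin s) (r n : ℕ) {F : MvPolynomial (Fin s) k} (hF : F ∈ I.formSpace P x (n + r)) :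
    partialHasseDeriv j r F ∈ I.formSpace P x n := by
  obtain ⟨hF, f, hf, hfF⟩ := hF
  obtain ⟨D, hD, hDx⟩ := hx.exists_diffOp_partialHasseDeriv j r
  refine ⟨hF.partialHasseDeriv j r, D f, ?_, ?_⟩
  · have := hI r D hD _ f hf
    simpa using this
  · have h1 : D f - aeval x (partialHasseDeriv j r F) = D (f - aeval x F) +
        (D (aeval x F) - aeval x (partialHasseDeriv j r F)) := by
      rw [map_sub]
      ring
    rw [h1]
    refine add_mem ?_ (hDx n F hF)
    have := hD.map_pow_le P hfF
    rwa [show n + r + 1 - r = n + 1 by omega] at this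

theorem finite_formSpace (I : IdealisticFiltration R) (P : Ideal R) {s : ℕ} (x : Fin s → R)
    (n : ℕ) : Module.Finite k (I.formSpace P x n : Submodule k (MvPolynomial (Fin s) k)) :=
  Submodule.finiteDimensional_of_le (S₂ := restrictTotalDegree (Fin s) k n) fun _ hF =>
    (mem_restrictTotalDegree ..).2 hF.1.totalDegree_le

section Pure

variable [Nontrivial R] [IsAlgClosed k] {p : ℕ} [ExpChar k p]

theorem mem_pureVectors {I : IdealisticFiltration R} {P : Ideal R} {s : ℕ} {x : Fin s → R} {e : ℕ}
    {v : Fin s → k} : v ∈ I.pureVectors p P x e ↔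
      ∃ f ∈ I.level (p ^ e : ℕ), f - (∑ i, v i • x i) ^ p ^ e ∈ P ^ (p ^ e + 1) := Iff.rfl

theorem pureVectors_mono (I : IdealisticFiltration R) (P : Ideal R) {s : ℕ}
    (x : Fin s → R) : Monotone (I.pureVectors (k := k) p P x) := by
  have : ExpChar R p := expChar_of_injective_algebraMap (algebraMap k R).injective p
  refine monotone_nat_of_le_succ fun e v hv => ?_
  obtain ⟨f, hf, hfv⟩ := hv
  refine ⟨f ^ p, ?_, ?_⟩
  · have := I.pow_mem_level hf p
    convert this using 2
    push_cast
    ring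
  · rw [pow_succ p e, pow_mul, ← sub_pow_expChar]
    refine Ideal.pow_le_pow_right ?_ (Ideal.pow_mem_pow hfv p |> fun h => by rwa [← pow_mul] at h)
    have := expChar_pos k p
    rw [add_mul]
    omega

theorem sum_C_mul_X_pow_mem_formSpace_iff {I : IdealisticFiltration R} {P : Ideal R} {s : ℕ}
    {x : Fin s → R} {e : ℕ} {w : Fin s → k} :
    ∑ j, C (w j ^ p ^ e) * X j ^ p ^ e ∈ I.formSpace P x (p ^ e) ↔
      w ∈ I.pureVectors p P x e := by
  have : ExpChar R p := expChar_of_injective_algebraMap (algebraMap k R).injective p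
  have h1 : aeval x (∑ j, C (w j ^ p ^ e) * X j ^ p ^ e) = (∑ i, w i • x i) ^ p ^ e := by
    rw [sum_pow_char_pow]
    simp [Algebra.smul_def, mul_pow]
  rw [mem_formSpace, mem_pureVectors, h1]
  refine and_iff_right (IsHomogeneous.sum _ _ _ fun j _ => ?_)
  simpa using (isHomogeneous_C _ (w j ^ p ^ e)).mul ((isHomogeneous_X k j).pow (p ^ e))

end Pure

end IdealisticFiltration

/-! ### The pure part in local coordinates -/

/-- A semilinear additive isomorphism between subspaces preserves finiteness and dimension. -/
theorem finrank_eq_of_semilinear {k V M : Type*} [Field k] [AddCommGroup V] [Module k V]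
    [AddCommGroup M] [Module k M] (U : Submodule k V) (W : Submodule k M) [Module.Finite k U]
    (i : k → k) (hi : Function.Bijective i) (φ : V →+ M) (hinj : ∀ v ∈ U, φ v = 0 → v = 0)
    (hsmul : ∀ c v, φ (c • v) = i c • φ v) (hrange : ∀ z, z ∈ W ↔ ∃ v ∈ U, φ v = z) :
    Module.Finite k W ∧ Module.finrank k W = Module.finrank k U := by
  let Φ : U →+ W := AddMonoidHom.mk' (fun v => ⟨φ v, (hrange _).2 ⟨v, v.2, rfl⟩⟩)
    (fun v w => Subtype.ext (φ.map_add v w))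
  have hbij : Function.Bijective Φ := by
    constructor
    · rw [injective_iff_map_eq_zero]
      exact fun v hv => Subtype.ext (hinj v v.2 (congrArg Subtype.val hv))
    · rintro ⟨z, hz⟩
      obtain ⟨v, hv, rfl⟩ := (hrange z).1 hz
      exact ⟨⟨v, hv⟩, rfl⟩
  have hrank := lift_rank_eq_of_equiv_equiv i (AddEquiv.ofBijective Φ hbij) hi
    (fun c v => Subtype.ext (hsmul c v))
  constructor
  · rw [← Module.rank_lt_aleph0_iff, ← Cardinal.lift_lt_aleph0, ← hrank,
      Cardinal.lift_lt_aleph0, Module.rank_lt_aleph0_iff]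
    infer_instance
  · have := congrArg Cardinal.toNat hrank
    rw [Cardinal.toNat_lift, Cardinal.toNat_lift] at this
    exact this.symm

namespace IdealisticFiltration

variable {k : Type u} {R : Type v} [Field k] [CommRing R] [Algebra k R]

/-- The jet of order `n` at `P` of an element of `R`, in `R_P / 𝔪_P ^ (n + 1)`. -/
def jet (P : MaximalSpectrum R) (n : ℕ) : R →+* Ambient P n :=
  (Ideal.Quotient.mk _).comp (algebraMap R (Localization.AtPrime P.asIdeal))

theorem mk_algebraMap_eq_jet (P : MaximalSpectrum R) (n : ℕ) (f : R) :
    (Ideal.Quotient.mk _ (algebraMap R (Localization.AtPrime P.asIdeal) f) : Ambient P n) =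
      jet P n f := rfl

theorem jet_smul (P : MaximalSpectrum R) (n : ℕ) (c : k) (f : R) :
    jet P n (c • f) = c • jet P n f := by
  rw [Algebra.smul_def, Algebra.smul_def, map_mul]
  rfl

theorem jet_eq_zero_iff (P : MaximalSpectrum R) (n : ℕ) (f : R) :
    jet P n f = 0 ↔ f ∈ P.asIdeal ^ (n + 1) := by
  have h := (IsLocalization.AtPrime.equivQuotMaximalIdealPow P.asIdeal
    (Localization.AtPrime P.asIdeal) (n + 1)).toRingEquiv.map_eq_zero_iff
    (x := Ideal.Quotient.mk _ f)
  rw [Ideal.Quotient.eq_zero_iff_mem] at h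
  exact h

theorem jet_eq_jet_iff (P : MaximalSpectrum R) (n : ℕ) (f g : R) :
    jet P n f = jet P n g ↔ f - g ∈ P.asIdeal ^ (n + 1) := by
  rw [← sub_eq_zero, ← map_sub, jet_eq_zero_iff]

theorem exists_jet_eq_of_mem_map (P : MaximalSpectrum R) (n : ℕ) (J : Ideal R)
    {z : Localization.AtPrime P.asIdeal}
    (hz : z ∈ J.map (algebraMap R (Localization.AtPrime P.asIdeal))) :
    ∃ g ∈ J, jet P n g = Ideal.Quotient.mk _ z := by
  obtain ⟨⟨g, t⟩, ht⟩ := (IsLocalization.mem_map_algebraMap_iff P.asIdeal.primeCompl _).1 hz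
  obtain ⟨u, hu⟩ := (Ideal.Quotient.isUnit_mk_pow_of_notMem P.asIdeal (n := n + 1)
    (Ideal.mem_primeCompl_iff.1 t.2)).exists_right_inv
  obtain ⟨u, rfl⟩ := Ideal.Quotient.mk_surjective u
  have h1 : jet P n (t * u) = 1 := by
    rw [← map_mul, ← map_one (Ideal.Quotient.mk _), Ideal.Quotient.eq] at hu
    rwa [← map_one (jet P n), jet_eq_jet_iff]
  refine ⟨g * u, Ideal.mul_mem_right _ _ g.2, ?_⟩
  have h2 : jet P n (g * u) = Ideal.Quotient.mk _ z * jet P n (t * u) := by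
    rw [map_mul, map_mul, ← mul_assoc]
    congr 1
    rw [← mk_algebraMap_eq_jet, ← mk_algebraMap_eq_jet, ← map_mul, ht]
  rw [h2, h1, mul_one]

variable [IsAlgClosed k] {p : ℕ} [ExpChar k p]

theorem jet_pow_mem_purePart {I : IdealisticFiltration R} {P : MaximalSpectrum R} {e : ℕ} {y f : R}
    (hy : y ∈ P.asIdeal) (hf : f ∈ I.level (p ^ e : ℕ))
    (hfy : f - y ^ p ^ e ∈ P.asIdeal ^ (p ^ e + 1)) :
    jet P (p ^ e) (y ^ p ^ e) ∈ I.purePart k p P e := by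
  have hmax : P.asIdeal.map (algebraMap R (Localization.AtPrime P.asIdeal)) =
      IsLocalRing.maximalIdeal _ := Localization.AtPrime.map_eq_maximalIdeal
  refine ⟨?_, algebraMap R _ y, ?_, ?_⟩
  · rw [← (jet_eq_jet_iff P _ _ _).2 hfy]
    refine Submodule.mem_map.2 ⟨algebraMap R _ f, ⟨Ideal.mem_map_of_mem _ hf, ?_⟩, rfl⟩
    rw [← hmax, ← Ideal.map_pow]
    refine Ideal.mem_map_of_mem _ ?_
    have h2 := add_mem (Ideal.pow_le_pow_right (Nat.le_succ _) hfy)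
      (Ideal.pow_mem_pow hy (p ^ e))
    rwa [sub_add_cancel] at h2
  · rw [← hmax]
    exact Ideal.mem_map_of_mem _ hy
  · rw [← map_pow, mk_algebraMap_eq_jet]

theorem exists_of_mem_purePart {I : IdealisticFiltration R} {P : MaximalSpectrum R} {e : ℕ}
    {z : Ambient P (p ^ e)} (hz : z ∈ I.purePart k p P e) :
    ∃ y ∈ P.asIdeal, ∃ f ∈ I.level (p ^ e : ℕ), f - y ^ p ^ e ∈ P.asIdeal ^ (p ^ e + 1) ∧
      jet P (p ^ e) (y ^ p ^ e) = z := by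
  obtain ⟨hz1, y₀, hy₀, hz2⟩ := hz
  obtain ⟨w, ⟨hw, -⟩, hwz⟩ := Submodule.mem_map.1 hz1
  obtain ⟨f, hf, hfw⟩ := exists_jet_eq_of_mem_map P (p ^ e) _ hw
  have hmax : P.asIdeal.map (algebraMap R (Localization.AtPrime P.asIdeal)) =
      IsLocalRing.maximalIdeal _ := Localization.AtPrime.map_eq_maximalIdeal
  rw [← hmax] at hy₀
  obtain ⟨y, hy, hye⟩ := exists_jet_eq_of_mem_map P (p ^ e) _ hy₀
  have h1 : jet P (p ^ e) (y ^ p ^ e) = z := by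
    rw [map_pow, hye, ← map_pow]
    exact hz2
  refine ⟨y, hy, f, hf, ?_, h1⟩
  rw [← jet_eq_jet_iff, h1, hfw]
  exact hwz

/-- In local coordinates the pure part in degree `p ^ e` is the Frobenius twist of the space
`pureVectors` of linear forms. -/
theorem finite_purePart_and_pureDim_eq [IsDomain R] [Algebra.FormallySmooth k R]
    (I : IdealisticFiltration R) (P : MaximalSpectrum R) {s : ℕ} {x : Fin s → R}
    (hx : IsLocalCoordinates k P.asIdeal x) (e : ℕ) : Module.Finite k (I.purePart k p P e) ∧
      I.pureDim k p P e = Module.finrank k (I.pureVectors p P.asIdeal x e : Submodule k _) := by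
  have : ExpChar R p := expChar_of_injective_algebraMap (algebraMap k R).injective p
  have hq : p ^ e ≠ 0 := pow_ne_zero e (expChar_pos k p).ne'
  obtain ⟨y, hy⟩ : ∃ y : (Fin s → k) → R, ∀ v, y v = ∑ i, v i • x i := ⟨_, fun v => rfl⟩
  have hyP : ∀ v, y v ∈ P.asIdeal := fun v => by
    rw [hy]
    exact sum_mem fun i _ => Submodule.smul_of_tower_mem _ _ (hx.mem i)
  have hyadd : ∀ v w, y (v + w) = y v + y w := fun v w => by
    simp [hy, add_smul, Finset.sum_add_distrib]
  have hysmul : ∀ (c : k) v, y (c • v) = c • y v := fun c v => by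
    simp [hy, Finset.smul_sum, smul_smul]
  have hyform : ∀ v : Fin s → k,
      aeval x (∑ j, C (v j ^ p ^ e) * X j ^ p ^ e) = y v ^ p ^ e := fun v => by
    rw [hy, sum_pow_char_pow]
    simp [Algebra.smul_def, mul_pow]
  have hmemV : ∀ v, v ∈ I.pureVectors p P.asIdeal x e ↔
      ∃ f ∈ I.level (p ^ e : ℕ), f - y v ^ p ^ e ∈ P.asIdeal ^ (p ^ e + 1) := fun v => by
    rw [hy]
    rfl
  refine finrank_eq_of_semilinear (I.pureVectors p P.asIdeal x e) (I.purePart k p P e)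
    (fun c : k => c ^ p ^ e) ⟨iterateFrobenius_inj k p e,
      fun c => IsAlgClosed.exists_pow_nat_eq c (Nat.pos_of_ne_zero hq)⟩
    (AddMonoidHom.mk' (fun v => jet P (p ^ e) (y v ^ p ^ e)) fun v w => by
      rw [hyadd, add_pow_expChar_pow, map_add]) (fun v _ hv => ?_)
    (fun c v => ?_) (fun z => ⟨fun hz => ?_, ?_⟩)
  · rw [AddMonoidHom.mk'_apply, jet_eq_zero_iff, ← hyform] at hv
    have h3 := hx.eq_zero_of_aeval_mem P.isMaximal.ne_top (IsHomogeneous.sum _ _ _ fun j _ => by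
      simpa using (isHomogeneous_C _ (v j ^ p ^ e)).mul ((isHomogeneous_X k j).pow (p ^ e))) hv
    funext j
    have h4 := congrArg (coeff (Finsupp.single j (p ^ e))) h3
    simp only [coeff_sum, coeff_C_mul, coeff_X_pow, coeff_zero] at h4
    rw [Finset.sum_eq_single j] at h4
    · rw [if_pos rfl, mul_one] at h4
      exact (pow_eq_zero_iff hq).1 h4
    · intro i _ hi
      rw [if_neg, mul_zero]
      rwa [Finsupp.single_left_inj hq]
    · simp
  · rw [AddMonoidHom.mk'_apply, hysmul, smul_pow, jet_smul]
  · obtain ⟨y₁, hy₁, f, hf, hfy, hjet⟩ := exists_of_mem_purePart hz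
    obtain ⟨v, hv⟩ := hx.exists_linear y₁ hy₁
    have h1 : jet P (p ^ e) (y v ^ p ^ e) = z := by
      rw [← hjet, jet_eq_jet_iff, ← sub_pow_expChar_pow]
      have h2 : y v - y₁ ∈ P.asIdeal ^ 2 := by
        rw [← neg_sub, hy]
        exact neg_mem hv
      have h3 := Ideal.pow_mem_pow h2 (p ^ e)
      rw [← pow_mul] at h3
      exact Ideal.pow_le_pow_right (by omega) h3
    refine ⟨v, (hmemV v).2 ⟨f, hf, ?_⟩, h1⟩
    rw [← jet_eq_jet_iff, h1, ← hjet, jet_eq_jet_iff]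
    exact hfy
  · rintro ⟨v, hv, rfl⟩
    obtain ⟨f, hf, hfv⟩ := (hmemV v).1 hv
    exact jet_pow_mem_purePart (hyP v) hf hfv

end IdealisticFiltration

/-! ### Semi-continuity -/

namespace IdealisticFiltration

variable {k : Type u} {R : Type v} [Field k] [IsAlgClosed k] [CommRing R] [Algebra k R]

section

variable [Nontrivial R] {p : ℕ} [ExpChar k p]

/-- At a point where some element of the filtration at level `n` vanishes to order less than `n`,
saturation puts a unit of the local ring at level `1`; hence the leading algebra is everything. -/
theorem pureVectors_eq_top [Algebra.Smooth k R] {I : IdealisticFiltration R}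
    (hI : I.IsDSaturated k) {P : Ideal R} [P.IsMaximal] {s : ℕ} {x : Fin s → R}
    (hx : IsLocalCoordinates k P x) {n : ℕ} (hn : ¬ I.level n ≤ P ^ n) (e : ℕ) :
    I.pureVectors p P x e = (⊤ : Submodule k (Fin s → k)) := by
  classical
  obtain ⟨f, hf, hfP⟩ := SetLike.not_le_iff_exists.1 hn
  have hex : ∃ m, f ∉ P ^ m := ⟨n, hfP⟩
  obtain ⟨m, hm⟩ : ∃ m, Nat.find hex = m + 1 := by
    refine Nat.exists_eq_succ_of_ne_zero fun h0 => ?_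
    have := Nat.find_spec hex
    rw [h0] at this
    simp at this
  have hm1 : f ∈ P ^ m := by
    by_contra h
    have := Nat.find_min' hex h
    omega
  have hm2 : f ∉ P ^ (m + 1) := hm ▸ Nat.find_spec hex
  have hmn : m + 1 ≤ n := hm ▸ Nat.find_min' hex hfP
  obtain ⟨D, hD, hDf⟩ := hx.exists_diffOp_notMem (Ideal.IsPrime.ne_top inferInstance)
    (exists_evaluation k P) hm1 hm2
  have hu : D f ∈ I.level 1 := by
    refine I.level_antitone _ _ ?_ (hI m D hD n f hf)
    have : ((m + 1 : ℕ) : ℝ) ≤ n := by exact_mod_cast hmn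
    push_cast at this
    linarith
  have huq := I.pow_mem_level hu (p ^ e)
  rw [mul_one] at huq
  have hnot : D f ^ p ^ e ∉ P := fun h => hDf (Ideal.IsPrime.mem_of_pow_mem inferInstance _ h)
  obtain ⟨w, hw⟩ := (Ideal.Quotient.isUnit_mk_pow_of_notMem P (n := p ^ e + 1)
    hnot).exists_right_inv
  obtain ⟨w, rfl⟩ := Ideal.Quotient.mk_surjective w
  rw [← map_mul, ← map_one (Ideal.Quotient.mk _), Ideal.Quotient.eq] at hw
  refine eq_top_iff.2 fun v _ => ⟨D f ^ p ^ e * (w * (∑ i, v i • x i) ^ p ^ e),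
    Ideal.mul_mem_right _ _ huq, ?_⟩
  have h1 : D f ^ p ^ e * (w * (∑ i, v i • x i) ^ p ^ e) - (∑ i, v i • x i) ^ p ^ e =
      (D f ^ p ^ e * w - 1) * (∑ i, v i • x i) ^ p ^ e := by ring
  rw [h1]
  exact Ideal.mul_mem_right _ _ hw

end

/-- The dimension of the leading algebra in degree `n` is lower semi-continuous on the locus where
elements at level `n` vanish to order at least `n`. -/
theorem exists_notMem_forall_finrank_formSpace_le [Algebra.Smooth k R]
    (I : IdealisticFiltration R) {P₀ : Ideal R} (hP₀ : P₀ ≠ ⊤) {s₀ : ℕ} {x₀ : Fin s₀ → R}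
    (hx₀ : IsLocalCoordinates k P₀ x₀) (n : ℕ) :
    ∃ g ∉ P₀, ∀ P : Ideal R, P.IsMaximal → g ∉ P → I.level n ≤ P ^ n →
      ∀ (s : ℕ) (x : Fin s → R), IsLocalCoordinates k P x →
        Module.finrank k (I.formSpace P₀ x₀ n : Submodule k (MvPolynomial (Fin s₀) k)) ≤
          Module.finrank k (I.formSpace P x n : Submodule k (MvPolynomial (Fin s) k)) := by
  have := I.finite_formSpace (k := k) P₀ x₀ n
  let b := Module.finBasis k (I.formSpace P₀ x₀ n : Submodule k (MvPolynomial (Fin s₀) k))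
  choose f hf hfb using fun i => (b i).2.2
  choose φ hφ using fun i => LinearMap.exists_extend (b.coord i)
  choose D hD hDx using fun i => hx₀.exists_diffOp_functional n (φ i)
  refine ⟨Matrix.det (Matrix.of fun i j => D i (f j)), det_notMem_of_sub_one_mem hP₀ fun i j => ?_,
    fun P hP hg hle s x hx => ?_⟩
  · have h1 := (hD i).map_pow_le P₀ (hfb j)
    rw [Nat.add_sub_cancel_left, pow_one] at h1
    have h2 : φ i (b j) = if i = j then 1 else 0 := by
      have := LinearMap.congr_fun (hφ i) (b j)
      rw [LinearMap.comp_apply, Submodule.subtype_apply] at this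
      rw [this, Module.Basis.coord_apply, Module.Basis.repr_self, Finsupp.single_apply]
      simp only [eq_comm]
    have h3 : algebraMap k R (φ i (b j)) = if i = j then 1 else 0 := by
      rw [h2]
      split_ifs <;> simp
    have h4 := add_mem h1 (hDx i (b j) (b j).2.1)
    rw [h3] at h4
    simpa using h4
  · choose G hG hfG using fun j => hx.exists_form (exists_evaluation k P) (hle (hf j))
    have := I.finite_formSpace (k := k) P x n
    let G' : Fin _ → (I.formSpace P x n : Submodule k (MvPolynomial (Fin s) k)) :=
      fun j => ⟨G j, hG j, f j, hf j, hfG j⟩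
    have hind : LinearIndependent k G' := by
      rw [Fintype.linearIndependent_iff]
      intro c hc
      refine congrFun (eq_zero_of_det_notMem hg (c := c) fun i => ?_)
      have h1 : ∑ j, c j • G j = 0 := by
        have := congrArg Subtype.val hc
        simpa [G'] using this
      have h2 : ∑ j, c j • f j ∈ P ^ (n + 1) := by
        have h3 : ∑ j, c j • (f j - aeval x (G j)) ∈ P ^ (n + 1) :=
          sum_mem fun j _ => Submodule.smul_of_tower_mem _ _ (hfG j)
        simp_rw [smul_sub, Finset.sum_sub_distrib, ← map_smul, ← map_sum, h1, map_zero,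
          sub_zero] at h3
        exact h3
      have h4 := (hD i).map_pow_le P h2
      rw [Nat.add_sub_cancel_left, pow_one, map_sum] at h4
      simpa using h4
    simpa using hind.fintype_card_le_finrank

section

variable [IsDomain R] {p : ℕ} [ExpChar k p] [Algebra.Smooth k R]

theorem pureDim_monotone (I : IdealisticFiltration R) (P : MaximalSpectrum R) :
    Monotone (I.pureDim k p P) := by
  obtain ⟨s, x, hx⟩ := exists_isLocalCoordinates (k := k) P.asIdeal
  intro i j hij
  rw [(I.finite_purePart_and_pureDim_eq P hx i).2, (I.finite_purePart_and_pureDim_eq P hx j).2]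
  exact Submodule.finrank_mono (I.pureVectors_mono P.asIdeal x hij)

theorem pureDim_le_card (I : IdealisticFiltration R) (P : MaximalSpectrum R) {s : ℕ}
    {x : Fin s → R} (hx : IsLocalCoordinates k P.asIdeal x) (e : ℕ) : I.pureDim k p P e ≤ s := by
  rw [(I.finite_purePart_and_pureDim_eq P hx e).2]
  simpa using Submodule.finrank_le (I.pureVectors (k := k) p P.asIdeal x e)

variable (k p) in
/-- Local coordinates adapted to the flag of pure parts up to degree `p ^ e`. -/
theorem exists_adapted_coordinates (I : IdealisticFiltration R) (P : MaximalSpectrum R) (e : ℕ) :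
    ∃ (s : ℕ) (x : Fin s → R), IsLocalCoordinates k P.asIdeal x ∧ ∀ i ≤ e, ∀ w : Fin s → k,
      w ∈ I.pureVectors p P.asIdeal x i ↔ ∀ j : Fin s, I.pureDim k p P i ≤ j → w j = 0 := by
  obtain ⟨s, x, hx⟩ := exists_isLocalCoordinates (k := k) P.asIdeal
  obtain ⟨b, hb⟩ := exists_basis_adapted _ (I.pureVectors_mono (k := k) (p := p) P.asIdeal x) e
  refine ⟨s, _, hx.change_basis b, fun i hi w => ?_⟩
  have h1 : ∑ j, w j • ∑ m, b j m • x m = ∑ m, (∑ j, w j • b j) m • x m := by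
    simp_rw [Finset.smul_sum, smul_smul]
    rw [Finset.sum_comm]
    refine Finset.sum_congr rfl fun m _ => ?_
    rw [← Finset.sum_smul]
    simp
  have h2 := hb i hi (∑ j, w j • b j)
  rw [Module.Basis.repr_sum_self, ← (I.finite_purePart_and_pureDim_eq P hx i).2] at h2
  rw [← h2, mem_pureVectors, mem_pureVectors, h1]

/-- The dimension of the leading algebra in degree `p ^ e` is determined by the dimensions of its
pure parts. -/
theorem finrank_formSpace_eq_ncard (hp : p.Prime) [CharP k p] {I : IdealisticFiltration R}
    (hI : I.IsDSaturated k) (P : MaximalSpectrum R) (e : ℕ) {s : ℕ} {x : Fin s → R}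
    (hx : IsLocalCoordinates k P.asIdeal x)
    (hadapted : ∀ i ≤ e, ∀ w : Fin s → k, w ∈ I.pureVectors p P.asIdeal x i ↔
      ∀ j : Fin s, I.pureDim k p P i ≤ j → w j = 0) :
    Module.finrank k (I.formSpace P.asIdeal x (p ^ e) : Submodule k (MvPolynomial (Fin s) k)) =
      {γ | γ ∈ adaptedExponents p e (I.pureDim k p P) s ∧ γ.degree = p ^ e}.ncard := by
  have hspace : (I.formSpace P.asIdeal x (p ^ e) : Submodule k (MvPolynomial (Fin s) k)) =
      restrictSupport k
        {γ | γ ∈ adaptedExponents p e (I.pureDim k p P) s ∧ γ.degree = p ^ e} := by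
    ext F
    rw [mem_iff_support_subset_adaptedExponents hp (I.pureDim_monotone (k := k) (p := p) P)
      (fun n => I.formSpace P.asIdeal x n) (fun n F hF => hF.1) (I.one_mem_formSpace P.asIdeal x)
      (I.mul_mem_formSpace hx.mem)
      (fun j i n F hF => partialHasseDeriv_mem_formSpace hI hx j (p ^ i) n hF)
      (fun i hi v => ?_) le_rfl, mem_restrictSupport_iff]
    · constructor
      · rintro ⟨h1, h2⟩ γ hγ
        refine ⟨h2 γ hγ, ?_⟩
        by_contra hne
        exact mem_support_iff.1 hγ (h1.coeff_eq_zero hne)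
      · intro h
        refine ⟨fun γ hγ => ?_, fun γ hγ => (h hγ).1⟩
        exact (DFunLike.congr_fun Finsupp.degree_eq_weight_one γ).symm.trans
          (h (mem_support_iff.2 hγ)).2
    · choose w hw using fun j => IsAlgClosed.exists_pow_nat_eq (v j) (pow_pos hp.pos i)
      have h1 := sum_C_mul_X_pow_mem_formSpace_iff (p := p) (I := I) (P := P.asIdeal) (x := x)
        (e := i) (w := w)
      simp only [hw] at h1
      rw [h1, hadapted i hi]
      refine forall₂_congr fun j _ => ?_
      rw [← hw, pow_eq_zero_iff (pow_pos hp.pos i).ne']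
  rw [hspace, Module.finrank_eq_nat_card_basis (basisRestrictSupport k _), Nat.card_coe_set_eq]

theorem finrank_formSpace_zero (I : IdealisticFiltration R) (P : MaximalSpectrum R) {s : ℕ}
    {x : Fin s → R} (hx : IsLocalCoordinates k P.asIdeal x) :
    Module.finrank k (I.formSpace P.asIdeal x (p ^ 0) : Submodule k (MvPolynomial (Fin s) k)) =
      I.pureDim k p P 0 := by
  classical
  let T : (Fin s → k) →ₗ[k] MvPolynomial (Fin s) k := Fintype.linearCombination k X
  have hT : ∀ w, T w = ∑ j, C (w j ^ p ^ 0) * X j ^ p ^ 0 := fun w => by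
    simp [T, Fintype.linearCombination_apply, smul_eq_C_mul]
  have hcoeff : ∀ w γ, coeff γ (T w) = ∑ j, if γ = Finsupp.single j 1 then w j else 0 := by
    intro w γ
    simp [hT, coeff_sum, coeff_C_mul, coeff_X, eq_comm]
  have hsingle : ∀ w i, coeff (Finsupp.single i 1) (T w) = w i := by
    intro w i
    rw [hcoeff, Finset.sum_eq_single i]
    · simp
    · intro j _ hj
      rw [if_neg]
      rw [Finsupp.single_left_inj one_ne_zero]
      exact Ne.symm hj
    · simp
  have hinj : Function.Injective T := fun v w h => by
    ext i
    rw [← hsingle v i, h, hsingle]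
  have hmap : (I.formSpace P.asIdeal x (p ^ 0) : Submodule k (MvPolynomial (Fin s) k)) =
      (I.pureVectors p P.asIdeal x 0).map T := by
    ext F
    rw [Submodule.mem_map]
    constructor
    · intro hF
      have hFT : T (fun j => coeff (Finsupp.single j 1) F) = F := by
        ext γ
        by_cases hγ : ∃ i, γ = Finsupp.single i 1
        · obtain ⟨i, rfl⟩ := hγ
          rw [hsingle]
        · rw [hcoeff, Finset.sum_eq_zero fun j _ => if_neg fun h => hγ ⟨j, h⟩]
          refine (hF.1.coeff_eq_zero fun hdeg => hγ ?_).symm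
          rw [pow_zero] at hdeg
          obtain ⟨i, hi⟩ := (Finsupp.sum_eq_one_iff γ).1 hdeg
          exact ⟨i, hi⟩
      refine ⟨_, ?_, hFT⟩
      rw [← sum_C_mul_X_pow_mem_formSpace_iff, ← hT, hFT]
      exact hF
    · rintro ⟨w, hw, rfl⟩
      rw [hT]
      exact sum_C_mul_X_pow_mem_formSpace_iff.2 hw
  rw [hmap, ← (Submodule.equivMapOfInjective T hinj _).finrank_eq,
    (I.finite_purePart_and_pureDim_eq P hx 0).2]

/-- Near a point `P₀`, if the pure parts in degrees below `p ^ e` keep their dimensions, then the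
dimension of the pure part in degree `p ^ e` does not drop. -/
theorem exists_notMem_forall_pureDim_le {I : IdealisticFiltration R} (hI : I.IsDSaturated k)
    (P₀ : MaximalSpectrum R) (e : ℕ) :
    ∃ g ∉ P₀.asIdeal, ∀ P : MaximalSpectrum R, g ∉ P.asIdeal →
      (∀ i < e, I.pureDim k p P i = I.pureDim k p P₀ i) →
        I.pureDim k p P₀ e ≤ I.pureDim k p P e := by
  obtain ⟨s₀, x₀, hx₀, hadapted₀⟩ := I.exists_adapted_coordinates k p P₀ e
  obtain ⟨g₁, hg₁, hcot⟩ := hx₀.exists_notMem_forall_le P₀.isMaximal.ne_top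
  obtain ⟨g₂, hg₂, hform⟩ :=
    I.exists_notMem_forall_finrank_formSpace_le P₀.isMaximal.ne_top hx₀ (p ^ e)
  refine ⟨g₁ * g₂, fun h => (P₀.isMaximal.isPrime.mem_or_mem h).elim hg₁ hg₂,
    fun P hg heq => ?_⟩
  obtain ⟨s, x, hx, hadapted⟩ := I.exists_adapted_coordinates k p P e
  by_cases hle : I.level (p ^ e : ℕ) ≤ P.asIdeal ^ p ^ e
  · have h1 := hform P.asIdeal P.isMaximal (fun h => hg (Ideal.mul_mem_left _ _ h)) hle s x hx
    obtain hp | rfl := expChar_is_prime_or_one k p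
    · have : CharP k p := by
        cases ‹ExpChar k p› with
        | zero => exact absurd hp Nat.not_prime_one
        | prime _ => infer_instance
      by_contra hlt
      rw [finrank_formSpace_eq_ncard hp hI P₀ e hx₀ hadapted₀,
        finrank_formSpace_eq_ncard hp hI P e hx hadapted] at h1
      exact absurd (ncard_adaptedExponents_lt hp (not_le.1 hlt) heq (I.pureDim_le_card P hx e)
        (I.pureDim_le_card P₀ hx₀ e)) (not_lt.2 h1)
    · -- In characteristic zero `p = 1`, and the pure part is the whole leading algebra in degree 1.
      have h2 : ∀ P : MaximalSpectrum R, I.pureDim k 1 P e = I.pureDim k 1 P 0 := by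
        intro P
        obtain ⟨s, x, hx⟩ := exists_isLocalCoordinates (k := k) P.asIdeal
        rw [(I.finite_purePart_and_pureDim_eq P hx e).2,
          (I.finite_purePart_and_pureDim_eq P hx 0).2]
        have : I.pureVectors (k := k) 1 P.asIdeal x e = I.pureVectors 1 P.asIdeal x 0 := by
          ext v
          simp only [mem_pureVectors, one_pow]
        rw [this]
      rw [one_pow] at h1
      rw [h2, h2, ← I.finrank_formSpace_zero P₀ hx₀, ← I.finrank_formSpace_zero P hx, one_pow]
      exact h1
  · rw [(I.finite_purePart_and_pureDim_eq P hx e).2, pureVectors_eq_top hI hx hle, finrank_top,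
      Module.finrank_fin_fun]
    exact (I.pureDim_le_card P₀ hx₀ e).trans (hcot P.asIdeal P.isMaximal.isPrime
      (exists_evaluation k P.asIdeal) (fun h => hg (Ideal.mul_mem_right _ _ h)) s x hx)

end

end IdealisticFiltration

theorem MaximalSpectrum.isClosed_of_forall_exists_notMem {R : Type v} [CommRing R]
    {Z : Set (MaximalSpectrum R)} (h : ∀ P₀ ∉ Z, ∃ g ∉ P₀.asIdeal, ∀ P : MaximalSpectrum R,
      g ∉ P.asIdeal → P ∉ Z) : IsClosed Z := by
  rw [← isOpen_compl_iff, isOpen_iff_forall_mem_open]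
  intro P₀ hP₀
  obtain ⟨g, hg, hgP⟩ := h P₀ hP₀
  exact ⟨_, hgP, (PrimeSpectrum.basicOpen g).2.preimage
    MaximalSpectrum.toPrimeSpectrum_continuous, hg⟩

theorem proposition1p2p2p1
    (k : Type u) [Field k] [IsAlgClosed k] (p : ℕ) [ExpChar k p]
    (R : Type v) [CommRing R] [IsDomain R] [Algebra k R] [Algebra.Smooth k R]
    (d : ℕ) (hd : ringKrullDim R = d)
    (I : IdealisticFiltration R) (hI : I.IsDSaturated k) :
    (∀ (P : MaximalSpectrum R) (e : ℕ),
      Module.Finite k (I.purePart k p P e) ∧ I.pureDim k p P e ≤ d) ∧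
    (∀ t : Lex (ℕ → ℕ), IsClosed {P : MaximalSpectrum R | t ≤ I.sigma k p d P}) ∧
    (CharZero k → ∀ t : ℕ, IsClosed {P : MaximalSpectrum R | t ≤ d - I.pureDim k p P 0}) := by
  have hle : ∀ (P : MaximalSpectrum R) (e : ℕ), I.pureDim k p P e ≤ d := by
    intro P e
    obtain ⟨s, x, hx⟩ := exists_isLocalCoordinates (k := k) P.asIdeal
    exact (I.pureDim_le_card P hx e).trans (hx.le_ringKrullDim hd P.isMaximal.ne_top)
  refine ⟨fun P e => ⟨?_, hle P e⟩, fun t => ?_, fun _ t => ?_⟩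
  · obtain ⟨s, x, hx⟩ := exists_isLocalCoordinates (k := k) P.asIdeal
    exact (I.finite_purePart_and_pureDim_eq P hx e).1
  · refine MaximalSpectrum.isClosed_of_forall_exists_notMem fun P₀ hP₀ => ?_
    -- Only the terms up to the first one at which `σ` at `P₀` falls below `t` matter.
    obtain ⟨e, heq, hlt⟩ := not_le.1 (show ¬ t ≤ I.sigma k p d P₀ from hP₀)
    choose g hg hgP using fun i => I.exists_notMem_forall_pureDim_le (p := p) hI P₀ i
    refine ⟨∏ i ∈ Finset.range (e + 1), g i, fun h => ?_, fun P hP => ?_⟩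
    · obtain ⟨i, -, hi⟩ := (P₀.isMaximal.isPrime.prod_mem_iff).1 h
      exact hg i hi
    · have hP' : ∀ i ≤ e, g i ∉ P.asIdeal := fun i hi h =>
        hP (P.isMaximal.isPrime.prod_mem_iff.2 ⟨i, Finset.mem_range.2 (by omega), h⟩)
      change ¬ t ≤ I.sigma k p d P
      rw [not_le]
      by_cases hall : ∀ i < e, I.pureDim k p P i = I.pureDim k p P₀ i
      · refine ⟨e, fun j hj => ?_, ?_⟩
        · rw [← heq j hj]
          change d - I.pureDim k p P j = d - I.pureDim k p P₀ j
          rw [hall j hj]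
        · refine lt_of_le_of_lt ?_ hlt
          exact Nat.sub_le_sub_left (hgP e P (hP' e le_rfl) hall) d
      · push Not at hall
        classical
        obtain ⟨hi, hne⟩ := Nat.find_spec hall
        have hmin : ∀ j < Nat.find hall, I.pureDim k p P j = I.pureDim k p P₀ j := by
          intro j hj
          by_contra h
          exact Nat.find_min hall hj ⟨hj.trans hi, h⟩
        refine ⟨Nat.find hall, fun j hj => ?_, ?_⟩
        · rw [← heq j (hj.trans hi)]
          change d - I.pureDim k p P j = d - I.pureDim k p P₀ j
          rw [hmin j hj]
        · rw [← heq _ hi]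
          change d - I.pureDim k p P _ < d - I.pureDim k p P₀ _
          have h1 := hgP _ P (hP' _ hi.le) hmin
          have h2 := hle P (Nat.find hall)
          omega
  · refine MaximalSpectrum.isClosed_of_forall_exists_notMem fun P₀ hP₀ => ?_
    obtain ⟨g, hg, hgP⟩ := I.exists_notMem_forall_pureDim_le (p := p) hI P₀ 0
    refine ⟨g, hg, fun P hP hPt => hP₀ (show t ≤ d - I.pureDim k p P₀ 0 from le_trans hPt ?_)⟩
    exact Nat.sub_le_sub_left (hgP P hP (by simp)) d
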